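/- **Setting.** Let $d\ge 1$, and let $P$ (source) and $Q$ (target) be probability distributions of a pair $(X,Y)$ with values in $[0,1]^d\times\{0,1\}$, with marginals $P_X,Q_X$ of $X$. Let $\eta_P,\eta_Q$ be their regression functions, $\eta_G(x)=G(Y=1\mid X=x)$ for $x\in\operatorname{supp}(G_X)$ and $\eta_G(x)=\tfrac12$ otherwise. Write $\lambda$ for Lebesgue measure, $\|\cdot\|$ for the Euclidean norm and $B(x,r)$ for the closed ball. Fix constants $\alpha\ge 0$, $0<\beta\le 1$, $\gamma>0$ with $\alpha\beta\le d$, and $C_\alpha,C_\beta,C_\gamma,\mu_-,c_\mu,r_\mu>0$, $\mu_+\in\mathbb R$. The parameter space $\Pi=\Pi(\alpha,\beta,\gamma,\mu)$ is the set of all pairs $(P,Q)$ such that 1. (relative signal exponent) for all $x\in\operatorname{supp}(P_X)\cup\operatorname{supp}(Q_X)$: $(\eta_P(x)-\tfrac12)(\eta_Q(x)-\tfrac12)\ge 0$ and $|\eta_P(x)-\tfrac12|\ge C_\gamma|\eta_Q(x)-\tfrac12|^\gamma$; 2. (margin) $Q_X(|\eta_Q(X)-\tfrac12|<t)\le C_\alpha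 t^\alpha$ for all $t>0$; 3. (smoothness) $|\eta_Q(x_1)-\eta_Q(x_2)|\le C_\beta\|x_1-x_2\|^\beta$ for all $x_1,x_2\in\operatorname{supp}(Q_X)$; 4. (common support and strong density) $P_X$ and $Q_X$ have Lebesgue densities, $\Omega:=\operatorname{supp}(P_X)=\operatorname{supp}(Q_X)$, $\lambda(\Omega\cap B(x,r))\ge c_\mu\lambda(B(x,r))$ for all $x\in\Omega$ and $0<r\le r_\mu$, and both densities take values strictly between $\mu_-$ and $\mu_+$ on $\Omega$. The conditions refer to suitable (measurable) versions of the regression functions and densities. **Classifier.** Given independent i.i.d. samples $(X_i^P,Y_i^P)_{i\le n_P}$ from $P$ and $(X_i^Q,Y_i^Q)_{i\le n_Q}$ from $Q$, put $n=n_P+n_Q$ and let $x\in\mathbb R^d$. For $1\le k\le n$, find the $k$ nearest covariates to $x$ in the combined sample (ties broken by index, source points first); let $k_P$ and $k_Q$ be the numbers of source and of target points among them, and let $\hat\eta_P^{(k)}$ and $\hat\eta_Q^{(k)}$ be the averages of the labels of these source and target points respectively (an average over no points is set to $\tfrac12$). With $a=\hat\eta_P^{(k)}-\tfrac12$ and $b=\hat\eta_Q^{(k)}-\tfrac12$,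 the signal-to-noise index is $$\hat r^{(k)}=\begin{cases}k_P a^2+k_Q b^2,&\operatorname{sign}a=\operatorname{sign}b,\\ \max(k_Pa^2,\,k_Qb^2),&\operatorname{sign}a\ne\operatorname{sign}b,\end{cases}\qquad \hat f^{(k)}(x)=\mathbf 1\{\sqrt{k_P}\,a+\sqrt{k_Q}\,b\ge 0\}.$$ The adaptive classifier is $\hat f_a(x)=\hat f^{(k^*)}(x)$, where $k^*$ is the smallest $k\in\{1,\dots,n\}$ with $\hat r^{(k)}>(d+3)\log n$ if there is one, and otherwise the (smallest) maximizer of $\hat r^{(k)}$ over $k\in\{1,\dots,n\}$. It does not depend on $\alpha,\beta,\gamma$ or on any of the other constants. **Excess risk.** For a classifier $f:\mathbb R^d\to\{0,1\}$ let $\mathcal E_Q(f)=Q(f(X)\ne Y)-Q(f_Q^*(X)\ne Y)$, where $f_Q^*(x)=\mathbf 1\{\eta_Q(x)>\tfrac12\}$ is the Bayes classifier. **Theorem 3.** There is a constant $C>0$, depending only on $d,\alpha,\beta,\gamma,C_\alpha,C_\beta,C_\gamma,\mu_-,\mu_+,c_\mu,r_\mu$ (and not on $n_P,n_Q$), such that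 for all integers $n_P,n_Q\ge 0$ with $n=n_P+n_Q\ge 2$, $$\sup_{(P,Q)\in\Pi}\ \mathbb E\,\mathcal E_Q(\hat f_a)\ \le\ C\left(\Big(\frac{n_P}{\log n}\Big)^{\frac{2\beta+d}{2\gamma\beta+d}}+\frac{n_Q}{\log n}\right)^{-\frac{\beta(1+\alpha)}{2\beta+d}},$$ where the expectation is over the two samples (the excess risk is an integrable function of the data). -/

import Mathlib

open MeasureTheory Set

noncomputable section

namespace PosteriorDrift

/-- Covariates live in `ℝ^d` with its Euclidean norm. -/
abbrev Covariate (d : ℕ) : Type := EuclideanSpace ℝ (Fin d)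

/-- A labelled observation `(X, Y)`; the label `1` is `true` and the label `0` is `false`. -/
abbrev Obs (d : ℕ) : Type := Covariate d × Bool

/-- The data: `nP` observations from the source and `nQ` observations from the target. -/
abbrev Sample (d nP nQ : ℕ) : Type := (Fin nP → Obs d) × (Fin nQ → Obs d)

/-- The numerical value of a label. -/
def labelValue (y : Bool) : ℝ := if y then 1 else 0

/-! ### Regression functions, risk and excess risk -/

/-- `η` is a version of the regression function `x ↦ G(Y = 1 | X = x)` of the distribution `G`,
with the convention `η = 1/2` off the support of the marginal distribution of `X`. -/
structure IsRegressionFunction {d : ℕ} (G : Measure (Obs d)) (η : Covariate d → ℝ) : Prop where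
  measurable : Measurable η
  mem_unit : ∀ x, η x ∈ Icc (0 : ℝ) 1
  joint : ∀ A : Set (Covariate d), MeasurableSet A →
    G (A ×ˢ {true}) = ∫⁻ x in A, ENNReal.ofReal (η x) ∂G.fst
  off_support : ∀ x, x ∉ G.fst.support → η x = 1 / 2

/-- The Bayes classifier of a distribution with regression function `η`. -/
def bayesClassifier {d : ℕ} (η : Covariate d → ℝ) (x : Covariate d) : Bool :=
  decide (1 / 2 < η x)

/-- The misclassification risk `R_Q(f) = Q(f(X) ≠ Y)`. -/
def risk {d : ℕ} (Q : Measure (Obs d)) (f : Covariate d → Bool) : ℝ :=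
  Q.real {z | f z.1 ≠ z.2}

/-- The excess risk `R_Q(f) - R_Q(f*)` of `f`, where `f*` is the Bayes classifier
given by the regression function `ηQ` of `Q`. -/
def excessRisk {d : ℕ} (Q : Measure (Obs d)) (ηQ : Covariate d → ℝ)
    (f : Covariate d → Bool) : ℝ :=
  risk Q f - risk Q (bayesClassifier ηQ)

/-! ### The posterior drift parameter space -/

/-- Relative signal exponent `γ` with constant `Cγ`. -/
def RelativeSignal {d : ℕ} (γ Cγ : ℝ) (P Q : Measure (Obs d)) (ηP ηQ : Covariate d → ℝ) : Prop :=
  ∀ x ∈ P.fst.support ∪ Q.fst.support,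
    0 ≤ (ηP x - 1 / 2) * (ηQ x - 1 / 2) ∧ Cγ * |ηQ x - 1 / 2| ^ γ ≤ |ηP x - 1 / 2|

/-- Margin assumption with exponent `α` and constant `Cα`. -/
def Margin {d : ℕ} (α Cα : ℝ) (Q : Measure (Obs d)) (ηQ : Covariate d → ℝ) : Prop :=
  ∀ t : ℝ, 0 < t → Q.fst.real {x | |ηQ x - 1 / 2| < t} ≤ Cα * t ^ α

/-- `(β, Cβ)`-Hölder smoothness on the set `Ω`. -/
def HolderOn {d : ℕ} (β Cβ : ℝ) (g : Covariate d → ℝ) (Ω : Set (Covariate d)) : Prop :=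
  ∀ x₁ ∈ Ω, ∀ x₂ ∈ Ω, |g x₁ - g x₂| ≤ Cβ * ‖x₁ - x₂‖ ^ β

/-- The distribution `ν` has a Lebesgue density that lies strictly between `μlo` and `μhi`
everywhere on the support of `ν`. -/
def HasBoundedDensity {d : ℕ} (μlo μhi : ℝ) (ν : Measure (Covariate d)) : Prop :=
  ∃ p : Covariate d → ℝ, Measurable p ∧ (∀ x, 0 ≤ p x) ∧
    ν = volume.withDensity (fun x => ENNReal.ofReal (p x)) ∧
    ∀ x ∈ ν.support, μlo < p x ∧ p x < μhi

/-- Common support and strong density assumption. -/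
structure StrongDensity {d : ℕ} (μlo μhi cμ rμ : ℝ) (νP νQ : Measure (Covariate d)) : Prop where
  common_support : νP.support = νQ.support
  regular : ∀ x ∈ νQ.support, ∀ r : ℝ, 0 < r → r ≤ rμ →
    ENNReal.ofReal cμ * volume (Metric.closedBall x r) ≤
      volume (νQ.support ∩ Metric.closedBall x r)
  density_source : HasBoundedDensity μlo μhi νP
  density_target : HasBoundedDensity μlo μhi νQ

/-- Membership of `(P, Q)`, with regression functions `ηP` and `ηQ`, in the posterior drift
parameter space `Π(α, Cα, β, Cβ, γ, Cγ, μ, cμ, rμ)`, where `μ = (μlo, μhi)`. -/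
structure ParameterSpace {d : ℕ} (α Cα β Cβ γ Cγ μlo μhi cμ rμ : ℝ)
    (P Q : Measure (Obs d)) (ηP ηQ : Covariate d → ℝ) : Prop where
  source_regression : IsRegressionFunction P ηP
  target_regression : IsRegressionFunction Q ηQ
  source_cube : ∀ᵐ x ∂P.fst, ∀ i, x i ∈ Icc (0 : ℝ) 1
  target_cube : ∀ᵐ x ∂Q.fst, ∀ i, x i ∈ Icc (0 : ℝ) 1
  signal : RelativeSignal γ Cγ P Q ηP ηQ
  margin : Margin α Cα Q ηQ
  smooth : HolderOn β Cβ ηQ Q.fst.support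
  density : StrongDensity μlo μhi cμ rμ P.fst Q.fst

/-! ### The data-driven classifier -/

section Classifier

variable {d nP nQ : ℕ}

/-- The covariates of the combined data set. -/
def covariate (Z : Sample d nP nQ) : Fin nP ⊕ Fin nQ → Covariate d :=
  Sum.elim (fun i => (Z.1 i).1) (fun i => (Z.2 i).1)

/-- Data point `i` comes before data point `j` when the data are listed by increasing distance
to `x`; equal distances are listed in the order of the indices, source data first. -/
def Precedes (Z : Sample d nP nQ) (x : Covariate d) (i j : Fin nP ⊕ Fin nQ) : Prop :=
  dist (covariate Z i) x < dist (covariate Z j) x ∨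
    (dist (covariate Z i) x = dist (covariate Z j) x ∧ toLex i < toLex j)

open Classical in
/-- The `k` nearest neighbours of `x` in the combined data set: the data points that are
preceded by fewer than `k` others. -/
def nearest (Z : Sample d nP nQ) (x : Covariate d) (k : ℕ) : Finset (Fin nP ⊕ Fin nQ) :=
  {i | (Finset.univ.filter (fun j => Precedes Z x j i)).card < k}

/-- The number of source points among the `k` nearest neighbours. -/
def countP (Z : Sample d nP nQ) (x : Covariate d) (k : ℕ) : ℕ := (nearest Z x k).toLeft.card

/-- The number of target points among the `k` nearest neighbours. -/
def countQ (Z : Sample d nP nQ) (x : Covariate d) (k : ℕ) : ℕ := (nearest Z x k).toRight.card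

/-- The average source label among the `k` nearest neighbours, `1/2` if there is none. -/
def etaHatP (Z : Sample d nP nQ) (x : Covariate d) (k : ℕ) : ℝ :=
  if countP Z x k = 0 then 1 / 2
  else (∑ i ∈ (nearest Z x k).toLeft, labelValue (Z.1 i).2) / (countP Z x k : ℝ)

/-- The average target label among the `k` nearest neighbours, `1/2` if there is none. -/
def etaHatQ (Z : Sample d nP nQ) (x : Covariate d) (k : ℕ) : ℝ :=
  if countQ Z x k = 0 then 1 / 2
  else (∑ i ∈ (nearest Z x k).toRight, labelValue (Z.2 i).2) / (countQ Z x k : ℝ)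

/-- The signal-to-noise ratio index of step `k`. -/
def snr (Z : Sample d nP nQ) (x : Covariate d) (k : ℕ) : ℝ :=
  if SignType.sign (etaHatP Z x k - 1 / 2) = SignType.sign (etaHatQ Z x k - 1 / 2) then
    (countP Z x k : ℝ) * (etaHatP Z x k - 1 / 2) ^ 2 +
      (countQ Z x k : ℝ) * (etaHatQ Z x k - 1 / 2) ^ 2
  else
    max ((countP Z x k : ℝ) * (etaHatP Z x k - 1 / 2) ^ 2)
      ((countQ Z x k : ℝ) * (etaHatQ Z x k - 1 / 2) ^ 2)

/-- The intermediate classifier of step `k`. -/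
def stepClassifier (Z : Sample d nP nQ) (x : Covariate d) (k : ℕ) : Bool :=
  decide (0 ≤ √(countP Z x k : ℝ) * (etaHatP Z x k - 1 / 2) +
    √(countQ Z x k : ℝ) * (etaHatQ Z x k - 1 / 2))

/-- The steps `k ∈ {1, …, nP + nQ}` at which the index exceeds `(d + 3) log (nP + nQ)`. -/
def stoppingSteps (Z : Sample d nP nQ) (x : Covariate d) : Set ℕ :=
  {k | k ∈ Icc 1 (nP + nQ) ∧ ((d : ℝ) + 3) * Real.log ((nP : ℝ) + nQ) < snr Z x k}

/-- The steps `k ∈ {1, …, nP + nQ}` at which the index is largest. -/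
def maximizingSteps (Z : Sample d nP nQ) (x : Covariate d) : Set ℕ :=
  {k | k ∈ Icc 1 (nP + nQ) ∧ ∀ j ∈ Icc 1 (nP + nQ), snr Z x j ≤ snr Z x k}

open Classical in
/-- The step whose intermediate classifier is output: the first one at which the index exceeds
the threshold, or, if there is none, the (first) one that maximizes the index. -/
def chosenStep (Z : Sample d nP nQ) (x : Covariate d) : ℕ :=
  if (stoppingSteps Z x).Nonempty then sInf (stoppingSteps Z x) else sInf (maximizingSteps Z x)

/-- The data-driven adaptive classifier. -/
def adaptiveClassifier (Z : Sample d nP nQ) (x : Covariate d) : Bool :=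
  stepClassifier Z x (chosenStep Z x)

end Classifier

/-- The law of the data: two independent i.i.d. samples from `P` and from `Q`. -/
def sampleLaw {d : ℕ} (P Q : Measure (Obs d)) (nP nQ : ℕ) : Measure (Sample d nP nQ) :=
  (Measure.pi fun _ : Fin nP => P).prod (Measure.pi fun _ : Fin nQ => Q)

end PosteriorDrift

end

/-! Fix a query point `x` with signal `Δ = |ηQ x - 1/2| > 0` and put `T = (d + 3) log n`. On a ball
of radius `r ∝ Δ ^ (1/β)`, smoothness keeps a target signal of at least `Δ/2` with the sign it has
at `x`, and the relative signal exponent gives the source a signal of at least `Cγ (Δ/2) ^ γ` with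
the same sign. Conditionally on the covariates, the neighbour sets are fixed and the labels
independent, so Hoeffding's inequality and a union bound over `k` show that, outside an event of
probability `O(n⁻²)`, no normalized label average misses its conditional mean by more than `√(T/2)`.

The decisive step is deterministic (`add_pos_of_snr`, `adaptive_sign`). As long as all `k`
neighbours lie in the ball, neither normalized average can exceed `√(T/2)` in the wrong direction.
An index above `T` therefore forces the weighted vote to have the correct sign, so stopping early
does no harm. If one sample has a count in the ball times squared signal of at least `4T`, the index
does exceed `T` no later than when the ball is exhausted. Neither `r` nor any smoothness constant
has to be known to the classifier.

By strong density the ball has mass of order `Δ ^ (d/β)`, so a sample of size `m` suffices once `m Δ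
^ (2g + d/β)` is a large multiple of `log n`, with `g = γ` for the source and `g = 1` for the
target. One of the two samples meets this whenever `Δ ≥ δ`, with `δ` proportional to the rate base
to the power `-β/(2β+d)` (`le_mul_rpow_of_rate`, `signal_sufficient`, `wrong_decision_le`). By
Tonelli only pointwise error probabilities matter: points with `Δ < δ` cost at most `2δ · Cα δ ^ α`
by the margin condition, all others `O(n⁻²)`, which `αβ ≤ d` makes negligible
(`integral_excessRisk_le`, `exp_neg_le_rate`). -/

namespace PosteriorDrift

open ProbabilityTheory

/-! ### Concentration of the labels and of the counts -/

/-- The uniform distribution on the unit interval. -/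
noncomputable abbrev unitUniform : Measure ℝ := volume.restrict (Icc (0 : ℝ) 1)

instance isProbabilityMeasure_unitUniform : IsProbabilityMeasure unitUniform :=
  ⟨by simp [unitUniform]⟩

theorem unitUniform_Iic {t : ℝ} (ht : t ∈ Icc (0 : ℝ) 1) :
    unitUniform (Iic t) = ENNReal.ofReal t := by
  rw [unitUniform, Measure.restrict_apply measurableSet_Iic,
    show Iic t ∩ Icc 0 1 = Icc 0 t by
      ext u; simp only [mem_inter_iff, mem_Iic, mem_Icc]
      constructor
      · rintro ⟨h1, h2, _⟩; exact ⟨h2, h1⟩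
      · rintro ⟨h1, h2⟩; exact ⟨h2, h1, h2.trans ht.2⟩]
  simp

/-- Drawing a label by comparing the regression function with a uniform variable. -/
noncomputable def drawLabel {d : ℕ} (η : Covariate d → ℝ) (p : Covariate d × ℝ) : Obs d :=
  (p.1, decide (p.2 ≤ η p.1))

theorem measurable_drawLabel {d : ℕ} {η : Covariate d → ℝ} (hη : Measurable η) :
    Measurable (drawLabel η) := by
  refine measurable_fst.prodMk (measurable_to_bool ?_)
  have : (fun p : Covariate d × ℝ => decide (p.2 ≤ η p.1)) ⁻¹' {true} = {p | p.2 ≤ η p.1} := by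
    ext p; simp
  rw [this]
  exact measurableSet_le measurable_snd (hη.comp measurable_fst)

/-- A uniform variable falls below `η x` with probability `η x`, so both laws agree on `A ×ˢ
{true}`, hence on `A ×ˢ {false}` by complement, hence on all rectangles. Realizing `G` on a product
space turns conditioning on the covariates into Fubini. -/
theorem drawLabel_map {d : ℕ} {G : Measure (Obs d)} [IsProbabilityMeasure G]
    {η : Covariate d → ℝ} (h : IsRegressionFunction G η) :
    (G.fst.prod unitUniform).map (drawLabel η) = G := by
  have hm := measurable_drawLabel h.measurable
  have : IsProbabilityMeasure ((G.fst.prod unitUniform).map (drawLabel η)) :=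
    Measure.isProbabilityMeasure_map hm.aemeasurable
  have key_univ : ∀ (G' : Measure (Obs d)) (A : Set (Covariate d)), MeasurableSet A →
      G' (A ×ˢ univ) = G'.fst A := by
    intro G' A hA
    rw [Measure.fst_apply hA]; congr 1; ext; simp
  have hfst : ((G.fst.prod unitUniform).map (drawLabel η)).fst = G.fst := by
    rw [Measure.fst, Measure.map_map measurable_fst hm]
    change (G.fst.prod unitUniform).map Prod.fst = _
    simp
  have htrue : ∀ A : Set (Covariate d), MeasurableSet A →
      ((G.fst.prod unitUniform).map (drawLabel η)) (A ×ˢ {true}) = G (A ×ˢ {true}) := by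
    intro A hA
    rw [h.joint A hA, Measure.map_apply hm (hA.prod (measurableSet_singleton _)),
      Measure.prod_apply (hm (hA.prod (measurableSet_singleton _))),
      ← lintegral_indicator hA]
    refine lintegral_congr fun x => ?_
    by_cases hx : x ∈ A
    · rw [indicator_of_mem hx, ← unitUniform_Iic (h.mem_unit x)]
      congr 1; ext u; simp [drawLabel, hx]
    · rw [indicator_of_notMem hx]
      have : Prod.mk x ⁻¹' (drawLabel η ⁻¹' (A ×ˢ {true})) = ∅ := by
        ext u; simp [drawLabel, hx]
      rw [this, measure_empty]
  have hfalse : ∀ (G' : Measure (Obs d)) [IsProbabilityMeasure G'] (A : Set (Covariate d)),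
      MeasurableSet A → G' (A ×ˢ {false}) = G'.fst A - G' (A ×ˢ {true}) := by
    intro G' _ A hA
    rw [← key_univ G' A hA, ← measure_sdiff (by gcongr; simp)
      (hA.prod (measurableSet_singleton _)).nullMeasurableSet (measure_ne_top _ _)]
    congr 1; ext ⟨x, y⟩; cases y <;> simp
  refine Measure.ext_prod fun {A B} hA _ => ?_
  by_cases ht : true ∈ B <;> by_cases hf : false ∈ B
  · have : B = univ := by ext y; cases y <;> simp [ht, hf]
    rw [this, key_univ _ A hA, key_univ _ A hA, hfst]
  · have : B = {true} := by ext y; cases y <;> simp [ht, hf]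
    rw [this, htrue A hA]
  · have : B = {false} := by ext y; cases y <;> simp [ht, hf]
    rw [this, hfalse _ A hA, hfalse _ A hA, htrue A hA, hfst]
  · have : B = ∅ := by ext y; cases y <;> simp [ht, hf]
    simp [this]

theorem pi_drawLabel_map {d m : ℕ} {G : Measure (Obs d)} [IsProbabilityMeasure G]
    {η : Covariate d → ℝ} (h : IsRegressionFunction G η) :
    ((Measure.pi fun _ : Fin m => G.fst).prod (Measure.pi fun _ : Fin m => unitUniform)).map
      (fun p i => drawLabel η (p.1 i, p.2 i)) = Measure.pi fun _ : Fin m => G := by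
  have hm := measurable_drawLabel h.measurable
  have : IsProbabilityMeasure ((G.fst.prod unitUniform).map (drawLabel η)) :=
    Measure.isProbabilityMeasure_map hm.aemeasurable
  have hp := measurePreserving_arrowProdEquivProdArrow (Covariate d) ℝ (Fin m)
    (fun _ => G.fst) (fun _ => unitUniform)
  rw [← hp.map_eq, Measure.map_map _ hp.measurable]
  · change Measure.map (fun (x : Fin m → Covariate d × ℝ) i => drawLabel η (x i)) _ = _
    rw [Measure.pi_map_pi fun _ => hm.aemeasurable]
    simp_rw [drawLabel_map h]
  · exact measurable_pi_lambda _ fun i => hm.comp (by fun_prop)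

/-- Hoeffding's inequality for labels drawn independently with given probabilities. -/
theorem uniform_hoeffding {m : ℕ} (q : Fin m → ℝ) (hq : ∀ i, q i ∈ Icc (0 : ℝ) 1)
    (S : Finset (Fin m)) {t : ℝ} (ht : 0 ≤ t) :
    (Measure.pi fun _ : Fin m => unitUniform)
      {u | √(S.card * t) < |∑ i ∈ S, (labelValue (decide (u i ≤ q i)) - q i)|} ≤
      ENNReal.ofReal (2 * Real.exp (-2 * t)) := by
  rcases S.eq_empty_or_nonempty with rfl | hS
  · simp
  have hSc : (0 : ℝ) < S.card := by exact_mod_cast hS.card_pos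
  have hmeas : ∀ i, Measurable fun u : ℝ => labelValue (decide (u ≤ q i)) := fun i => by
    refine (measurable_of_countable labelValue).comp (measurable_to_bool ?_)
    have : (fun u : ℝ => decide (u ≤ q i)) ⁻¹' {true} = Iic (q i) := by ext; simp
    rw [this]; exact measurableSet_Iic
  have hint : ∀ i, ∫ u, labelValue (decide (u ≤ q i)) ∂unitUniform = q i := fun i => by
    have : (fun u : ℝ => labelValue (decide (u ≤ q i))) = (Iic (q i)).indicator 1 := by
      ext u; by_cases hu : u ≤ q i <;> simp [labelValue, hu]
    rw [this, integral_indicator_one measurableSet_Iic, Measure.real, unitUniform_Iic (hq i),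
      ENNReal.toReal_ofReal (hq i).1]
  let f : Fin m → (Fin m → ℝ) → ℝ := fun i u => labelValue (decide (u i ≤ q i)) - q i
  have hsub : ∀ i, HasSubgaussianMGF (f i) ((‖(1 : ℝ) - 0‖₊ / 2) ^ 2)
      (Measure.pi fun _ : Fin m => unitUniform) := fun i => by
    have h1 := hasSubgaussianMGF_of_mem_Icc (μ := unitUniform) (a := 0) (b := 1)
      (hmeas i).aemeasurable
      (ae_of_all _ fun u => by unfold labelValue; split_ifs <;> simp)
    rw [hint i] at h1
    have hp := measurePreserving_eval (fun _ : Fin m => unitUniform) i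
    rw [← hp.map_eq] at h1
    exact h1.of_map hp.measurable.aemeasurable
  have hind : iIndepFun f (Measure.pi fun _ : Fin m => unitUniform) :=
    iIndepFun_pi (X := fun i u => labelValue (decide (u ≤ q i)) - q i)
      fun i => ((hmeas i).sub_const _).aemeasurable
  have hind' : iIndepFun (fun i u => -f i u) (Measure.pi fun _ : Fin m => unitUniform) :=
    hind.comp (fun _ y => -y) fun _ => measurable_neg
  have hε : (0 : ℝ) ≤ √(S.card * t) := Real.sqrt_nonneg _
  have b1 := HasSubgaussianMGF.measure_sum_ge_le_of_iIndepFun hind (s := S)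
    (fun i _ => hsub i) hε
  have b2 := HasSubgaussianMGF.measure_sum_ge_le_of_iIndepFun hind' (s := S)
    (fun i _ => (hsub i).neg) hε
  -- A variable in `[0, 1]` is sub-Gaussian with parameter `1/4`, so the sum has parameter `|S|/4`
  -- and `|S|` cancels.
  have hexp : -√(S.card * t) ^ 2 / (2 * ((∑ i ∈ S, (‖(1 : ℝ) - 0‖₊ / 2) ^ 2 : NNReal) : ℝ)) =
      -2 * t := by
    rw [Real.sq_sqrt (by positivity)]
    simp
    field_simp
  rw [hexp] at b1 b2
  refine (measure_mono (t := {u | √(S.card * t) ≤ ∑ i ∈ S, f i u} ∪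
    {u | √(S.card * t) ≤ ∑ i ∈ S, -f i u}) ?_).trans ?_
  · intro u hu
    rw [mem_ofPred_eq, lt_abs] at hu
    rcases hu with hu | hu
    · exact Or.inl hu.le
    · right
      rw [mem_ofPred_eq, Finset.sum_neg_distrib]
      exact hu.le
  · refine (measure_union_le _ _).trans ?_
    rw [two_mul, ENNReal.ofReal_add (by positivity) (by positivity)]
    rw [← ofReal_measureReal, ← ofReal_measureReal]
    gcongr

/-- Hoeffding's inequality, conditional on the covariates: the set of labels that are summed
may depend on the covariates. -/
theorem hoeffding_of_selection {d m : ℕ} {G : Measure (Obs d)} [IsProbabilityMeasure G]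
    {η : Covariate d → ℝ} (h : IsRegressionFunction G η)
    (S : (Fin m → Covariate d) → Finset (Fin m)) {t : ℝ} (ht : 0 ≤ t)
    (hA : MeasurableSet {z : Fin m → Obs d | √((S fun i => (z i).1).card * t) <
      |∑ i ∈ S fun i => (z i).1, (labelValue (z i).2 - η (z i).1)|}) :
    (Measure.pi fun _ : Fin m => G) {z : Fin m → Obs d | √((S fun i => (z i).1).card * t) <
      |∑ i ∈ S fun i => (z i).1, (labelValue (z i).2 - η (z i).1)|} ≤
      ENNReal.ofReal (2 * Real.exp (-2 * t)) := by
  have hm := measurable_drawLabel h.measurable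
  have hM : Measurable fun (p : (Fin m → Covariate d) × (Fin m → ℝ)) i =>
      drawLabel η (p.1 i, p.2 i) := measurable_pi_lambda _ fun i => hm.comp (by fun_prop)
  rw [← pi_drawLabel_map h, Measure.map_apply hM hA, Measure.prod_apply (hM hA)]
  refine (lintegral_mono (g := fun _ => ENNReal.ofReal (2 * Real.exp (-2 * t)))
    fun x => ?_).trans (by simp)
  exact uniform_hoeffding (fun i => η (x i)) (fun i => h.mem_unit _) (S x) ht

/-- Lower tail of the number of data points in a given set. -/
theorem count_lower_tail {E : Type*} [MeasurableSpace E] {G : Measure E} [IsProbabilityMeasure G]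
    {m : ℕ} {B : Set E} (hB : MeasurableSet B) [DecidablePred (· ∈ B)] {p : ℝ}
    (hp : p ≤ G.real B) :
    (Measure.pi fun _ : Fin m => G)
      {z | ((Finset.univ.filter fun i => z i ∈ B).card : ℝ) < m * p / 2} ≤
      ENNReal.ofReal (Real.exp (-(m * p / 8))) := by
  set μ := Measure.pi fun _ : Fin m => G
  -- Chernoff's method with parameter `-1`: `g = exp (-1_B)`, whose mean is at most `exp (-5p/8)`
  -- because `1 - 1/e > 5/8`. Markov's inequality then leaves the exponent `1/2 - 5/8 = -1/8`.
  let g : E → ℝ := fun x => 1 - (1 - Real.exp (-1)) * B.indicator 1 x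
  have he : Real.exp (-1) < 3 / 8 := by
    have := Real.exp_neg_one_lt_d9; linarith
  have he0 := Real.exp_pos (-1)
  have hgm : Measurable g :=
    measurable_const.sub (measurable_const.mul (measurable_one.indicator hB))
  have hg : ∀ x, g x = Real.exp (-(if x ∈ B then 1 else 0)) := fun x => by
    by_cases hx : x ∈ B <;> simp [g, hx]
  have hg0 : ∀ x, 0 < g x := fun x => by rw [hg]; exact Real.exp_pos _
  have hprod : ∀ z : Fin m → E, ∏ i, g (z i) =
      Real.exp (-((Finset.univ.filter fun i => z i ∈ B).card : ℝ)) := fun z => by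
    simp_rw [hg]
    rw [← Real.exp_sum, Finset.sum_neg_distrib]
    simp
  have hgi : ∫ x, g x ∂G ≤ Real.exp (-(5 / 8 * p)) := by
    have : ∫ x, g x ∂G = 1 - (1 - Real.exp (-1)) * G.real B := by
      simp only [g]
      rw [integral_sub (integrable_const _)
        (((integrable_const 1).indicator hB).const_mul _), integral_const_mul,
        integral_indicator_one hB]
      simp
    rw [this]
    have h1 := Real.add_one_le_exp (-((1 - Real.exp (-1)) * G.real B))
    have h2 : 0 ≤ G.real B := measureReal_nonneg
    calc _ ≤ Real.exp (-((1 - Real.exp (-1)) * G.real B)) := by linarith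
      _ ≤ _ := by
        apply Real.exp_le_exp.2
        nlinarith
  have hint : ∫ z, ∏ i, g (z i) ∂μ ≤ Real.exp (-(5 / 8 * (m * p))) := by
    rw [integral_fintype_prod_eq_pow (μ := G) g, Fintype.card_fin]
    calc _ ≤ (Real.exp (-(5 / 8 * p))) ^ m := by
          gcongr
          exact integral_nonneg fun x => (hg0 x).le
      _ = _ := by rw [← Real.exp_nat_mul]; congr 1; ring
  have hmarkov := mul_meas_ge_le_integral_of_nonneg (μ := μ) (f := fun z => ∏ i, g (z i))
    (ae_of_all _ fun z => Finset.prod_nonneg fun i _ => (hg0 _).le)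
    (by
      refine Integrable.of_mem_Icc 0 1 ?_ (ae_of_all _ fun z => ?_)
      · exact (Finset.measurable_prod _ fun i _ =>
          hgm.comp (measurable_pi_apply i)).aemeasurable
      · simp only [hprod]
        exact ⟨(Real.exp_pos _).le, Real.exp_le_one_iff.2 (by simp)⟩) (Real.exp (-(m * p / 2)))
  rw [← ofReal_measureReal]
  apply ENNReal.ofReal_le_ofReal
  have hmono : μ.real {z | ((Finset.univ.filter fun i => z i ∈ B).card : ℝ) < m * p / 2} ≤
      μ.real {z | Real.exp (-(m * p / 2)) ≤ ∏ i, g (z i)} := by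
    refine measureReal_mono fun z hz => ?_
    simp only [mem_ofPred_eq, hprod] at hz ⊢
    exact Real.exp_le_exp.2 (by linarith)
  refine hmono.trans ?_
  have h3 := hmarkov.trans hint
  rw [← le_div_iff₀' (Real.exp_pos _), ← Real.exp_sub] at h3
  refine h3.trans (Real.exp_le_exp.2 ?_)
  linarith

end PosteriorDrift

namespace PosteriorDrift

/-! ### Measurability of the classifier -/

variable {d nP nQ : ℕ}

/-- The finite information about the data and the query point that determines the classifier:
the order of the data points and their labels. -/
noncomputable def pattern (p : Sample d nP nQ × Covariate d) :
    ((Fin nP ⊕ Fin nQ) × (Fin nP ⊕ Fin nQ) → Bool) × ((Fin nP → Bool) × (Fin nQ → Bool)) :=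
  open Classical in
  (fun ij => decide (Precedes p.1 p.2 ij.1 ij.2),
    (fun i => (p.1.1 i).2, fun i => (p.1.2 i).2))

theorem measurable_covariate (i : Fin nP ⊕ Fin nQ) :
    Measurable fun p : Sample d nP nQ × Covariate d => covariate p.1 i := by
  rcases i with i | i
  · change Measurable fun p : Sample d nP nQ × Covariate d => (p.1.1 i).1
    fun_prop
  · change Measurable fun p : Sample d nP nQ × Covariate d => (p.1.2 i).1
    fun_prop

theorem measurableSet_precedes (i j : Fin nP ⊕ Fin nQ) :
    MeasurableSet {p : Sample d nP nQ × Covariate d | Precedes p.1 p.2 i j} := by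
  have h : ∀ i : Fin nP ⊕ Fin nQ, Measurable fun p : Sample d nP nQ × Covariate d =>
      dist (covariate p.1 i) p.2 := fun i => (measurable_covariate i).dist measurable_snd
  exact (measurableSet_lt (h i) (h j)).union
    ((measurableSet_eq_fun (h i) (h j)).inter (MeasurableSet.const _))

theorem measurable_pattern : Measurable (pattern : Sample d nP nQ × Covariate d → _) := by
  classical
  refine Measurable.prodMk (measurable_pi_lambda _ fun ij => measurable_to_bool ?_)
    (Measurable.prodMk (by fun_prop) (by fun_prop))
  convert! measurableSet_precedes (d := d) ij.1 ij.2 using 1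
  ext p; simp

theorem precedes_congr {p p' : Sample d nP nQ × Covariate d} (h : pattern p = pattern p') :
    Precedes p.1 p.2 = Precedes p'.1 p'.2 := by
  funext i j
  have := congrFun (congrArg Prod.fst h) (i, j)
  simpa [pattern] using this

theorem nearest_congr {p p' : Sample d nP nQ × Covariate d} (h : pattern p = pattern p') :
    nearest p.1 p.2 = nearest p'.1 p'.2 := by
  funext k
  unfold nearest
  rw [precedes_congr h]

theorem sourceLabel_congr {p p' : Sample d nP nQ × Covariate d} (h : pattern p = pattern p')
    (i : Fin nP) : (p.1.1 i).2 = (p'.1.1 i).2 :=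
  congrFun (congrArg (fun q => q.2.1) h) i

theorem targetLabel_congr {p p' : Sample d nP nQ × Covariate d} (h : pattern p = pattern p')
    (i : Fin nQ) : (p.1.2 i).2 = (p'.1.2 i).2 :=
  congrFun (congrArg (fun q => q.2.2) h) i

/-- A function of the data and the query point that only depends on their pattern is
measurable. -/
theorem measurable_of_pattern {β : Type*} [MeasurableSpace β] [Nonempty β]
    {f : Sample d nP nQ × Covariate d → β}
    (h : ∀ p p', pattern p = pattern p' → f p = f p') : Measurable f := by
  -- Patterns form a finite space, on which every function is measurable.
  obtain ⟨e, rfl⟩ := (Function.factorsThrough_iff f).1 fun p p' hp => h p p' hp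
  exact (measurable_of_countable e).comp measurable_pattern

theorem adaptiveClassifier_congr {p p' : Sample d nP nQ × Covariate d}
    (h : pattern p = pattern p') :
    adaptiveClassifier p.1 p.2 = adaptiveClassifier p'.1 p'.2 := by
  have hP : countP p.1 p.2 = countP p'.1 p'.2 := by
    funext k; simp only [countP, nearest_congr h]
  have hQ : countQ p.1 p.2 = countQ p'.1 p'.2 := by
    funext k; simp only [countQ, nearest_congr h]
  have eP : etaHatP p.1 p.2 = etaHatP p'.1 p'.2 := by
    funext k; simp only [etaHatP, nearest_congr h, hP, sourceLabel_congr h]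
  have eQ : etaHatQ p.1 p.2 = etaHatQ p'.1 p'.2 := by
    funext k; simp only [etaHatQ, nearest_congr h, hQ, targetLabel_congr h]
  have hs : snr p.1 p.2 = snr p'.1 p'.2 := by
    funext k; simp only [snr, hP, hQ, eP, eQ]
  have hsteps : stoppingSteps p.1 p.2 = stoppingSteps p'.1 p'.2 := by
    simp only [stoppingSteps, hs]
  have hmax : maximizingSteps p.1 p.2 = maximizingSteps p'.1 p'.2 := by
    simp only [maximizingSteps, hs]
  have hc : chosenStep p.1 p.2 = chosenStep p'.1 p'.2 := by
    unfold chosenStep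
    rw [hsteps, hmax]
  simp only [adaptiveClassifier, stepClassifier, hP, hQ, eP, eQ, hc]

theorem measurable_adaptiveClassifier :
    Measurable fun p : Sample d nP nQ × Covariate d => adaptiveClassifier p.1 p.2 :=
  measurable_of_pattern fun _ _ => adaptiveClassifier_congr

/-! ### Deviation events for the label sums over nearest neighbours. -/

/-- The event that the labels of the source points among the `k` nearest neighbours deviate
from their conditional means. -/
def sourceDeviation (ηP : Covariate d → ℝ) (x : Covariate d) (t : ℝ) (k : ℕ) :
    Set (Sample d nP nQ) :=
  {Z | √((nearest Z x k).toLeft.card * t) <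
    |∑ i ∈ (nearest Z x k).toLeft, (labelValue (Z.1 i).2 - ηP (Z.1 i).1)|}

/-- The event that the labels of the target points among the `k` nearest neighbours deviate
from their conditional means. -/
def targetDeviation (ηQ : Covariate d → ℝ) (x : Covariate d) (t : ℝ) (k : ℕ) :
    Set (Sample d nP nQ) :=
  {Z | √((nearest Z x k).toRight.card * t) <
    |∑ i ∈ (nearest Z x k).toRight, (labelValue (Z.2 i).2 - ηQ (Z.2 i).1)|}

theorem measurableSet_nearest_eq (x : Covariate d) (k : ℕ) (S : Finset (Fin nP ⊕ Fin nQ)) :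
    MeasurableSet {Z : Sample d nP nQ | nearest Z x k = S} := by
  have h : Measurable fun p : Sample d nP nQ × Covariate d => decide (nearest p.1 p.2 k = S) :=
    measurable_of_pattern fun p p' hp => by rw [nearest_congr hp]
  have hx : Measurable fun Z : Sample d nP nQ => (Z, x) := measurable_id.prodMk measurable_const
  convert! (h.comp hx) (measurableSet_singleton true) using 1
  ext Z; simp

theorem measurable_labelDeviation {m : ℕ} {η : Covariate d → ℝ} (hη : Measurable η) (i : Fin m) :
    Measurable fun z : Fin m → Obs d => labelValue (z i).2 - η (z i).1 :=
  ((measurable_of_countable labelValue).comp (by fun_prop)).sub (hη.comp (by fun_prop))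

theorem measurableSet_sourceDeviation {ηP : Covariate d → ℝ} (hη : Measurable ηP)
    (x : Covariate d) (t : ℝ) (k : ℕ) :
    MeasurableSet (sourceDeviation ηP x t k : Set (Sample d nP nQ)) := by
  have : (sourceDeviation ηP x t k : Set (Sample d nP nQ)) = ⋃ S : Finset (Fin nP ⊕ Fin nQ),
      {Z | nearest Z x k = S} ∩ {Z | √(S.toLeft.card * t) <
        |∑ i ∈ S.toLeft, (labelValue (Z.1 i).2 - ηP (Z.1 i).1)|} := by
    ext Z; simp [sourceDeviation]
  rw [this]
  refine MeasurableSet.iUnion fun S => (measurableSet_nearest_eq x k S).inter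
    (measurableSet_lt measurable_const (Measurable.abs
      (Finset.measurable_sum _ fun i _ => ?_)))
  exact (measurable_labelDeviation hη i).comp measurable_fst

theorem measurableSet_targetDeviation {ηQ : Covariate d → ℝ} (hη : Measurable ηQ)
    (x : Covariate d) (t : ℝ) (k : ℕ) :
    MeasurableSet (targetDeviation ηQ x t k : Set (Sample d nP nQ)) := by
  have : (targetDeviation ηQ x t k : Set (Sample d nP nQ)) = ⋃ S : Finset (Fin nP ⊕ Fin nQ),
      {Z | nearest Z x k = S} ∩ {Z | √(S.toRight.card * t) <
        |∑ i ∈ S.toRight, (labelValue (Z.2 i).2 - ηQ (Z.2 i).1)|} := by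
    ext Z; simp [targetDeviation]
  rw [this]
  refine MeasurableSet.iUnion fun S => (measurableSet_nearest_eq x k S).inter
    (measurableSet_lt measurable_const (Measurable.abs
      (Finset.measurable_sum _ fun i _ => ?_)))
  exact (measurable_labelDeviation hη i).comp measurable_snd

theorem nearest_eq_of_covariate_eq {Z Z' : Sample d nP nQ} (h : covariate Z = covariate Z') :
    nearest Z = nearest Z' := by
  have hp : Precedes Z = Precedes Z' := by
    funext x i j
    simp only [Precedes, h]
  funext x k
  unfold nearest
  rw [hp]

/-- With the target sample frozen, the selected source indices depend on the source covariates
alone, so the conditional Hoeffding inequality applies; integrating over the target sample keeps the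
bound. -/
theorem sourceDeviation_le {P Q : Measure (Obs d)} [IsProbabilityMeasure P]
    [IsProbabilityMeasure Q] {ηP : Covariate d → ℝ} (h : IsRegressionFunction P ηP)
    (x : Covariate d) {t : ℝ} (ht : 0 ≤ t) (k : ℕ) :
    sampleLaw P Q nP nQ (sourceDeviation ηP x t k) ≤
      ENNReal.ofReal (2 * Real.exp (-2 * t)) := by
  have hA := measurableSet_sourceDeviation (nP := nP) (nQ := nQ) h.measurable x t k
  rw [sampleLaw, Measure.prod_apply_symm hA]
  refine (lintegral_mono (g := fun _ => ENNReal.ofReal (2 * Real.exp (-2 * t)))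
    fun w => ?_).trans (by simp)
  -- The label `true` is a dummy: neighbours do not depend on labels.
  let S : (Fin nP → Covariate d) → Finset (Fin nP) := fun X =>
    (nearest ((fun i => (X i, true), w) : Sample d nP nQ) x k).toLeft
  have hS : ∀ z : Fin nP → Obs d, (nearest ((z, w) : Sample d nP nQ) x k).toLeft =
      S fun i => (z i).1 := fun z => by
    simp only [S]
    rw [nearest_eq_of_covariate_eq (Z := (z, w)) (Z' := (fun i => ((z i).1, true), w)) rfl]
  have he : (fun z => (z, w)) ⁻¹' (sourceDeviation ηP x t k : Set (Sample d nP nQ)) =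
      {z : Fin nP → Obs d | √((S fun i => (z i).1).card * t) <
      |∑ i ∈ S fun i => (z i).1, (labelValue (z i).2 - ηP (z i).1)|} := by
    ext z
    simp only [sourceDeviation, mem_preimage, mem_ofPred_eq, hS]
  rw [he]
  refine hoeffding_of_selection h S ht ?_
  rw [← he]
  exact hA.preimage (by fun_prop)

theorem targetDeviation_le {P Q : Measure (Obs d)} [IsProbabilityMeasure P]
    [IsProbabilityMeasure Q] {ηQ : Covariate d → ℝ} (h : IsRegressionFunction Q ηQ)
    (x : Covariate d) {t : ℝ} (ht : 0 ≤ t) (k : ℕ) :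
    sampleLaw P Q nP nQ (targetDeviation ηQ x t k) ≤
      ENNReal.ofReal (2 * Real.exp (-2 * t)) := by
  have hA := measurableSet_targetDeviation (nP := nP) (nQ := nQ) h.measurable x t k
  rw [sampleLaw, Measure.prod_apply hA]
  refine (lintegral_mono (g := fun _ => ENNReal.ofReal (2 * Real.exp (-2 * t)))
    fun w => ?_).trans (by simp)
  let S : (Fin nQ → Covariate d) → Finset (Fin nQ) := fun X =>
    (nearest ((w, fun i => (X i, true)) : Sample d nP nQ) x k).toRight
  have hS : ∀ z : Fin nQ → Obs d, (nearest ((w, z) : Sample d nP nQ) x k).toRight =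
      S fun i => (z i).1 := fun z => by
    simp only [S]
    rw [nearest_eq_of_covariate_eq (Z := (w, z)) (Z' := (w, fun i => ((z i).1, true))) rfl]
  have he : Prod.mk w ⁻¹' (targetDeviation ηQ x t k : Set (Sample d nP nQ)) =
      {z : Fin nQ → Obs d | √((S fun i => (z i).1).card * t) <
      |∑ i ∈ S fun i => (z i).1, (labelValue (z i).2 - ηQ (z i).1)|} := by
    ext z
    simp only [targetDeviation, mem_preimage, mem_ofPred_eq, hS]
  rw [he]
  refine hoeffding_of_selection h S ht ?_
  rw [← he]
  exact hA.preimage (by fun_prop)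

end PosteriorDrift

namespace PosteriorDrift

/-! ### Correctness of the classifier on the event without deviations -/

section Deterministic

variable {d nP nQ : ℕ}

-- A point outside the ball is preceded by every point inside it, hence by at least `k` points.
open Classical in
theorem dist_le_of_mem_nearest {Z : Sample d nP nQ} {x : Covariate d} {r : ℝ} {k : ℕ}
    (hk : k ≤ (Finset.univ.filter fun i => dist (covariate Z i) x ≤ r).card)
    {i : Fin nP ⊕ Fin nQ} (hi : i ∈ nearest Z x k) : dist (covariate Z i) x ≤ r := by
  by_contra hr
  simp only [nearest, Finset.mem_filter, Finset.mem_univ, true_and] at hi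
  refine absurd (hi.trans_le hk) (not_lt.2 (Finset.card_le_card fun j hj => ?_))
  simp only [Finset.mem_filter, Finset.mem_univ, true_and] at hj ⊢
  exact Or.inl (hj.trans_lt (not_le.1 hr))

-- All predecessors of `i` lie in the ball, and `i` itself is a point of the ball that does not
-- precede itself, so there are strictly fewer of them than points in the ball. Ties on the sphere
-- cause no trouble.
open Classical in
theorem mem_nearest_of_dist_le {Z : Sample d nP nQ} {x : Covariate d} {r : ℝ}
    {i : Fin nP ⊕ Fin nQ} (hi : dist (covariate Z i) x ≤ r) :
    i ∈ nearest Z x (Finset.univ.filter fun i => dist (covariate Z i) x ≤ r).card := by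
  simp only [nearest, Finset.mem_filter, Finset.mem_univ, true_and]
  refine Finset.card_lt_card (Finset.ssubset_iff_subset_ne.2 ⟨fun j hj => ?_, fun h => ?_⟩)
  · refine Finset.mem_filter.2 ⟨Finset.mem_univ _, ?_⟩
    rcases (Finset.mem_filter.1 hj).2 with h | h
    · exact h.le.trans hi
    · exact h.1.le.trans hi
  · have : i ∈ Finset.univ.filter fun i => dist (covariate Z i) x ≤ r := by simpa using hi
    rw [← h] at this
    rcases (Finset.mem_filter.1 this).2 with h | h
    · exact lt_irrefl _ h
    · exact lt_irrefl _ h.2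

open Classical in
theorem nearest_toLeft_eq (Z : Sample d nP nQ) (x : Covariate d) (r : ℝ) :
    (nearest Z x (Finset.univ.filter fun i => dist (covariate Z i) x ≤ r).card).toLeft =
      Finset.univ.filter fun i => dist (Z.1 i).1 x ≤ r := by
  ext i
  rw [Finset.mem_toLeft]
  exact ⟨fun h => by simpa [covariate] using dist_le_of_mem_nearest le_rfl h,
    fun h => mem_nearest_of_dist_le (by simpa [covariate] using h)⟩

open Classical in
theorem nearest_toRight_eq (Z : Sample d nP nQ) (x : Covariate d) (r : ℝ) :
    (nearest Z x (Finset.univ.filter fun i => dist (covariate Z i) x ≤ r).card).toRight =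
      Finset.univ.filter fun i => dist (Z.2 i).1 x ≤ r := by
  ext i
  rw [Finset.mem_toRight]
  exact ⟨fun h => by simpa [covariate] using dist_le_of_mem_nearest le_rfl h,
    fun h => mem_nearest_of_dist_le (by simpa [covariate] using h)⟩

/-- The signed, normalized average label exceeds the signal up to the size of the deviation. -/
theorem signed_average_ge {ι : Type*} (A : Finset ι) (y η : ι → ℝ) {s σ t : ℝ}
    (hs : |s| = 1) (hσ : ∀ i ∈ A, σ ≤ s * (η i - 1 / 2))
    (hdev : |∑ i ∈ A, (y i - η i)| ≤ √(A.card * t)) :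
    √A.card * σ - √t ≤
      s * (√A.card * ((if A.card = 0 then 1 / 2 else (∑ i ∈ A, y i) / A.card) - 1 / 2)) := by
  have ht0 := Real.sqrt_nonneg t
  -- An empty average is `1/2`, so the claim reads `-√t ≤ 0`.
  by_cases hA : A.card = 0
  · simp [hA]
  have hpos : (0 : ℝ) < A.card := by exact_mod_cast Nat.pos_of_ne_zero hA
  have hsq : 0 < √(A.card : ℝ) := Real.sqrt_pos.2 hpos
  rw [if_neg hA]
  have hself : √(A.card : ℝ) * √A.card = A.card := Real.mul_self_sqrt hpos.le
  have hsum : s * (∑ i ∈ A, y i - A.card / 2) =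
      s * ∑ i ∈ A, (y i - η i) + ∑ i ∈ A, s * (η i - 1 / 2) := by
    rw [← Finset.mul_sum, ← mul_add, ← Finset.sum_add_distrib]
    simp [Finset.sum_sub_distrib, div_eq_mul_inv]
  have h1 : A.card * σ ≤ ∑ i ∈ A, s * (η i - 1 / 2) := by
    rw [← nsmul_eq_mul]
    exact Finset.card_nsmul_le_sum _ _ _ hσ
  have h2 : -√(A.card * t) ≤ s * ∑ i ∈ A, (y i - η i) := by
    refine (abs_le.1 ?_).1
    rw [abs_mul, hs, one_mul]
    exact hdev
  rw [Real.sqrt_mul hpos.le] at h2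
  have h3 : √(A.card : ℝ) * (√A.card * σ - √t) ≤ s * (∑ i ∈ A, y i - A.card / 2) := by
    rw [hsum, mul_sub, ← mul_assoc, hself]
    linarith
  refine le_of_mul_le_mul_left (h3.trans_eq ?_) hsq
  rw [show √(A.card : ℝ) * (s * (√A.card * ((∑ i ∈ A, y i) / A.card - 1 / 2))) =
    s * ((√(A.card : ℝ) * √A.card) * ((∑ i ∈ A, y i) / A.card - 1 / 2)) by ring, hself]
  congr 1
  field_simp

theorem sq_le_snr_source (Z : Sample d nP nQ) (x : Covariate d) (k : ℕ) :
    (√(countP Z x k) * (etaHatP Z x k - 1 / 2)) ^ 2 ≤ snr Z x k := by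
  rw [mul_pow, Real.sq_sqrt (Nat.cast_nonneg _), snr]
  split_ifs
  · exact le_add_of_nonneg_right (by positivity)
  · exact le_max_left _ _

theorem sq_le_snr_target (Z : Sample d nP nQ) (x : Covariate d) (k : ℕ) :
    (√(countQ Z x k) * (etaHatQ Z x k - 1 / 2)) ^ 2 ≤ snr Z x k := by
  rw [mul_pow, Real.sq_sqrt (Nat.cast_nonneg _), snr]
  split_ifs
  · exact le_add_of_nonneg_left (by positivity)
  · exact le_max_right _ _

/-- Expresses the index through the normalized averages `u`, `v`. Equality of signs is weakened to
`0 ≤ u * v`, a form unaffected by multiplying both by `s = ±1`. -/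
theorem snr_cases (Z : Sample d nP nQ) (x : Covariate d) (k : ℕ) :
    (0 ≤ (√(countP Z x k) * (etaHatP Z x k - 1 / 2)) * (√(countQ Z x k) *
        (etaHatQ Z x k - 1 / 2)) ∧
      snr Z x k = (√(countP Z x k) * (etaHatP Z x k - 1 / 2)) ^ 2 +
        (√(countQ Z x k) * (etaHatQ Z x k - 1 / 2)) ^ 2) ∨
    snr Z x k = (√(countP Z x k) * (etaHatP Z x k - 1 / 2)) ^ 2 ∨
    snr Z x k = (√(countQ Z x k) * (etaHatQ Z x k - 1 / 2)) ^ 2 := by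
  simp only [mul_pow, Real.sq_sqrt (Nat.cast_nonneg _)]
  unfold snr
  split_ifs with h
  · refine Or.inl ⟨?_, rfl⟩
    have hab : 0 ≤ (etaHatP Z x k - 1 / 2) * (etaHatQ Z x k - 1 / 2) := by
      rw [← sign_nonneg_iff, sign_mul, h]
      cases SignType.sign (etaHatQ Z x k - 1 / 2) <;> decide
    calc 0 ≤ √(countP Z x k) * √(countQ Z x k) *
          ((etaHatP Z x k - 1 / 2) * (etaHatQ Z x k - 1 / 2)) := by positivity
      _ = _ := by ring
  · exact Or.inr (max_choice _ _)

/-- If `u` and `v` were both nonpositive, then `u² + v² ≤ T`; so when their signs agree and the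
index exceeds `T`, the sum is positive. If a single square exceeds `T`, that variable must be above
`√T`, and the other cannot fall below `-√(T/2)`. The lower bounds by `√(T/2)` are what make both
cases work. -/
theorem add_pos_of_snr {u v w T : ℝ} (hT : 0 < T) (hu : -√(T / 2) ≤ u) (hv : -√(T / 2) ≤ v)
    (hw : T < w) (h : (0 ≤ u * v ∧ w = u ^ 2 + v ^ 2) ∨ w = u ^ 2 ∨ w = v ^ 2) : 0 < u + v := by
  have h2 : √(T / 2) ^ 2 = T / 2 := Real.sq_sqrt (by positivity)
  have h0 := Real.sqrt_nonneg (T / 2)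
  by_contra! hneg
  rcases h with ⟨huv, rfl⟩ | rfl | rfl
  · have hu0 : u ≤ 0 := by nlinarith [mul_self_nonneg u]
    have hv0 : v ≤ 0 := by nlinarith [mul_self_nonneg v]
    nlinarith
  · rcases le_or_gt u 0 with h | h
    · nlinarith
    · nlinarith
  · rcases le_or_gt v 0 with h | h
    · nlinarith
    · nlinarith

/-- The factor `4` gives `u ≥ 2√T - √(T/2) > √T`. -/
theorem lt_sq_of_signal {c σ T : ℝ} {u : ℝ} (hc : 0 ≤ c) (hσ : 0 ≤ σ) (hT : 0 < T)
    (h : 4 * T ≤ c * σ ^ 2) (hu : √c * σ - √(T / 2) ≤ u) : T < u ^ 2 := by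
  have h1 : 2 * √T ≤ √c * σ := by
    have := Real.sqrt_le_sqrt h
    rwa [Real.sqrt_mul hc, Real.sqrt_sq hσ, Real.sqrt_mul (by norm_num),
      show (4 : ℝ) = 2 ^ 2 by norm_num, Real.sqrt_sq (by norm_num)] at this
  have h2 : √(T / 2) < √T := Real.sqrt_lt_sqrt (by positivity) (by linarith)
  have h3 : √T ^ 2 = T := Real.sq_sqrt hT.le
  have h4 := Real.sqrt_pos.2 hT
  nlinarith

open Classical in
/-- On the event without deviations, the adaptive classifier finds the sign `s` of the signal as
soon as the signal within some distance `r` of the query point is strong enough. -/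
theorem adaptive_sign {Z : Sample d nP nQ} {x : Covariate d} {ηP ηQ : Covariate d → ℝ}
    {r s σP σQ T : ℝ} (hTdef : T = ((d : ℝ) + 3) * Real.log ((nP : ℝ) + nQ)) (hT : 0 < T)
    (hs : |s| = 1) (hσP : 0 ≤ σP) (hσQ : 0 ≤ σQ)
    (hP : ∀ i, dist (Z.1 i).1 x ≤ r → σP ≤ s * (ηP (Z.1 i).1 - 1 / 2))
    (hQ : ∀ i, dist (Z.2 i).1 x ≤ r → σQ ≤ s * (ηQ (Z.2 i).1 - 1 / 2))
    (hdP : ∀ k ∈ Icc 1 (nP + nQ), Z ∉ sourceDeviation ηP x (T / 2) k)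
    (hdQ : ∀ k ∈ Icc 1 (nP + nQ), Z ∉ targetDeviation ηQ x (T / 2) k)
    (hbig : 4 * T ≤ (Finset.univ.filter fun i => dist (Z.1 i).1 x ≤ r).card * σP ^ 2 ∨
      4 * T ≤ (Finset.univ.filter fun i => dist (Z.2 i).1 x ≤ r).card * σQ ^ 2) :
    0 < s * (√(countP Z x (chosenStep Z x)) * (etaHatP Z x (chosenStep Z x) - 1 / 2) +
      √(countQ Z x (chosenStep Z x)) * (etaHatQ Z x (chosenStep Z x) - 1 / 2)) := by
  set k₀ := (Finset.univ.filter fun i => dist (covariate Z i) x ≤ r).card with hk₀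
  have hk₀n : k₀ ≤ nP + nQ := by
    refine (Finset.card_le_univ _).trans (by simp)
  have hleft := nearest_toLeft_eq Z x r
  have hright := nearest_toRight_eq Z x r
  rw [← hk₀] at hleft hright
  -- An empty ball would make both counts in `hbig` zero, against `0 < T`.
  have hk₀1 : 1 ≤ k₀ := by
    by_contra h0
    have h0 : k₀ = 0 := by omega
    have hne : nearest Z x k₀ = ∅ := by rw [h0]; ext i; simp [nearest]
    rw [hne] at hleft hright
    have hl : (∅ : Finset (Fin nP ⊕ Fin nQ)).toLeft = ∅ := by ext; simp
    have hr : (∅ : Finset (Fin nP ⊕ Fin nQ)).toRight = ∅ := by ext; simp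
    rw [← hleft, ← hright, hl, hr] at hbig
    have : 4 * T ≤ 0 := by simpa using hbig
    linarith
  -- Needed for every `k ≤ k₀`, not only `k₀`, since the procedure may stop earlier.
  have hu : ∀ k ∈ Icc 1 k₀, √(countP Z x k) * σP - √(T / 2) ≤
      s * (√(countP Z x k) * (etaHatP Z x k - 1 / 2)) := fun k hk =>
    signed_average_ge (nearest Z x k).toLeft (fun i => labelValue (Z.1 i).2)
      (fun i => ηP (Z.1 i).1) hs
      (fun i hi => hP i (by
        simpa [covariate] using dist_le_of_mem_nearest hk.2 (Finset.mem_toLeft.1 hi)))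
      (not_lt.1 (hdP k ⟨hk.1, hk.2.trans hk₀n⟩))
  have hv : ∀ k ∈ Icc 1 k₀, √(countQ Z x k) * σQ - √(T / 2) ≤
      s * (√(countQ Z x k) * (etaHatQ Z x k - 1 / 2)) := fun k hk =>
    signed_average_ge (nearest Z x k).toRight (fun i => labelValue (Z.2 i).2)
      (fun i => ηQ (Z.2 i).1) hs
      (fun i hi => hQ i (by
        simpa [covariate] using dist_le_of_mem_nearest hk.2 (Finset.mem_toRight.1 hi)))
      (not_lt.1 (hdQ k ⟨hk.1, hk.2.trans hk₀n⟩))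
  have hs2 : s ^ 2 = 1 := by rw [← sq_abs, hs, one_pow]
  have hsteps : k₀ ∈ stoppingSteps Z x := by
    refine ⟨⟨hk₀1, hk₀n⟩, ?_⟩
    rw [← hTdef]
    rcases hbig with hb | hb
    · rw [← hleft] at hb
      have := lt_sq_of_signal (Nat.cast_nonneg _) hσP hT hb (hu k₀ ⟨hk₀1, le_rfl⟩)
      rw [mul_pow, hs2, one_mul] at this
      exact this.trans_le (sq_le_snr_source Z x k₀)
    · rw [← hright] at hb
      have := lt_sq_of_signal (Nat.cast_nonneg _) hσQ hT hb (hv k₀ ⟨hk₀1, le_rfl⟩)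
      rw [mul_pow, hs2, one_mul] at this
      exact this.trans_le (sq_le_snr_target Z x k₀)
  have hc : chosenStep Z x = sInf (stoppingSteps Z x) := by
    unfold chosenStep
    rw [if_pos ⟨k₀, hsteps⟩]
  have hmem : chosenStep Z x ∈ stoppingSteps Z x := by
    rw [hc]; exact Nat.sInf_mem ⟨k₀, hsteps⟩
  have hle : chosenStep Z x ≤ k₀ := by rw [hc]; exact Nat.sInf_le hsteps
  set k := chosenStep Z x
  have hkI : k ∈ Icc 1 k₀ := ⟨hmem.1.1, hle⟩
  have hu' := hu k hkI
  have hv' := hv k hkI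
  have hp1 : 0 ≤ √(countP Z x k : ℝ) * σP := by positivity
  have hp2 : 0 ≤ √(countQ Z x k : ℝ) * σQ := by positivity
  have hgt := hmem.2
  rw [← hTdef] at hgt
  rw [mul_add]
  refine add_pos_of_snr hT (by linarith) (by linarith) hgt ?_
  -- Since `s² = 1`, the sign `s` drops out of the squares and of the product.
  rw [mul_pow s, mul_pow s, hs2, one_mul, one_mul, mul_mul_mul_comm, ← sq, hs2, one_mul]
  exact snr_cases Z x k

end Deterministic

end PosteriorDrift

namespace PosteriorDrift

/-! ### Probability of a wrong decision at a given point -/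

section Pointwise

variable {d : ℕ}

/-- The volume of the Euclidean unit ball. -/
noncomputable def unitBallVolume (d : ℕ) : ℝ :=
  (volume : Measure (Covariate d)).real (Metric.ball 0 1)

theorem unitBallVolume_pos (d : ℕ) : 0 < unitBallVolume d :=
  ENNReal.toReal_pos (Metric.measure_ball_pos _ _ one_pos).ne' measure_ball_lt_top.ne

/-- The density is bounded below only on the support, so it is integrated over the part of the ball
inside the support, whose volume the regularity condition controls. -/
theorem ball_mass_ge {μlo μhi cμ r : ℝ} {ν : Measure (Covariate d)} [IsProbabilityMeasure ν]
    {x : Covariate d} (h : HasBoundedDensity μlo μhi ν) (hμ : 0 ≤ μlo) (hc : 0 ≤ cμ) (hr : 0 ≤ r)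
    (hreg : ENNReal.ofReal cμ * volume (Metric.closedBall x r) ≤
      volume (ν.support ∩ Metric.closedBall x r)) :
    μlo * cμ * unitBallVolume d * r ^ d ≤ ν.real (Metric.closedBall x r) := by
  obtain ⟨p, hpm, hp0, hν, hp⟩ := h
  have hms : MeasurableSet (ν.support ∩ Metric.closedBall x r) :=
    (Measure.isClosed_support (μ := ν)).measurableSet.inter measurableSet_closedBall
  rw [Measure.real, ← ENNReal.ofReal_le_iff_le_toReal (measure_ne_top _ _)]
  have hv : volume (Metric.closedBall x r) =
      ENNReal.ofReal (r ^ d) * ENNReal.ofReal (unitBallVolume d) := by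
    rw [Measure.addHaar_closedBall _ _ hr, unitBallVolume, ofReal_measureReal
      measure_ball_lt_top.ne]
    simp
  calc ENNReal.ofReal (μlo * cμ * unitBallVolume d * r ^ d)
      = ENNReal.ofReal μlo * (ENNReal.ofReal cμ * volume (Metric.closedBall x r)) := by
        rw [hv, ← ENNReal.ofReal_mul (by positivity), ← ENNReal.ofReal_mul hc,
          ← ENNReal.ofReal_mul hμ]
        congr 1; ring
    _ ≤ ENNReal.ofReal μlo * volume (ν.support ∩ Metric.closedBall x r) := by gcongr
    _ = ∫⁻ _ in ν.support ∩ Metric.closedBall x r, ENNReal.ofReal μlo := by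
        rw [setLIntegral_const]
    _ ≤ ∫⁻ y in ν.support ∩ Metric.closedBall x r, ENNReal.ofReal (p y) :=
        setLIntegral_mono' hms fun y hy => ENNReal.ofReal_le_ofReal (hp y hy.1).1.le
    _ = (volume.withDensity fun y => ENNReal.ofReal (p y))
          (ν.support ∩ Metric.closedBall x r) := by rw [withDensity_apply _ hms]
    _ = ν (ν.support ∩ Metric.closedBall x r) := by rw [← hν]
    _ ≤ ν (Metric.closedBall x r) := measure_mono inter_subset_right

theorem ae_pi_forall_mem {m : ℕ} {G : Measure (Obs d)} [IsProbabilityMeasure G] :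
    ∀ᵐ z ∂(Measure.pi fun _ : Fin m => G), ∀ i, (z i).1 ∈ G.fst.support := by
  rw [ae_all_iff]
  intro i
  have h : ∀ᵐ z ∂G, z.1 ∈ G.fst.support :=
    ae_of_ae_map measurable_fst.aemeasurable (Measure.support_mem_ae (μ := G.fst))
  exact (Measure.quasiMeasurePreserving_eval (fun _ : Fin m => G) i).ae h

open Classical in
theorem ball_count_lower_tail {m : ℕ} {G : Measure (Obs d)} [IsProbabilityMeasure G]
    {x : Covariate d} {r p : ℝ} (hp : p ≤ G.fst.real (Metric.closedBall x r)) :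
    (Measure.pi fun _ : Fin m => G)
      {z | ((Finset.univ.filter fun i => dist (z i).1 x ≤ r).card : ℝ) < m * p / 2} ≤
      ENNReal.ofReal (Real.exp (-(m * p / 8))) := by
  have hB : MeasurableSet (Prod.fst ⁻¹' Metric.closedBall x r : Set (Obs d)) :=
    measurable_fst measurableSet_closedBall
  rw [Measure.real, Measure.fst_apply measurableSet_closedBall] at hp
  exact count_lower_tail hB hp

section

variable {α Cα β Cβ γ Cγ μlo μhi cμ rμ : ℝ} {P Q : Measure (Obs d)}
  {ηP ηQ : Covariate d → ℝ}

/-- Near a point `x` of the support the target regression function keeps half of its signal. -/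
theorem target_signal (h : ParameterSpace α Cα β Cβ γ Cγ μlo μhi cμ rμ P Q ηP ηQ)
    (hβ : 0 < β) (hCβ : 0 < Cβ) {x y : Covariate d} (hx : x ∈ Q.fst.support)
    (hy : y ∈ Q.fst.support) {r s Δ : ℝ} (hs : |s| = 1) (hΔ : s * (ηQ x - 1 / 2) = Δ)
    (hr : Cβ * r ^ β ≤ Δ / 2) (hyr : dist y x ≤ r) : Δ / 2 ≤ s * (ηQ y - 1 / 2) := by
  have h1 := h.smooth y hy x hx
  rw [← dist_eq_norm] at h1
  have h2 : dist y x ^ β ≤ r ^ β := Real.rpow_le_rpow dist_nonneg hyr hβ.le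
  have h3 : |s * (ηQ y - ηQ x)| ≤ Δ / 2 := by
    rw [abs_mul, hs, one_mul]
    exact h1.trans ((mul_le_mul_of_nonneg_left h2 hCβ.le).trans hr)
  have h4 := (abs_le.1 h3).1
  linarith

/-- The source regression function inherits the signal of the target. -/
theorem source_signal (h : ParameterSpace α Cα β Cβ γ Cγ μlo μhi cμ rμ P Q ηP ηQ)
    (hγ : 0 < γ) (hCγ : 0 < Cγ) {y : Covariate d} (hy : y ∈ Q.fst.support)
    {s σ : ℝ} (hs : |s| = 1) (hσ : 0 < σ) (hQ : σ ≤ s * (ηQ y - 1 / 2)) :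
    Cγ * σ ^ γ ≤ s * (ηP y - 1 / 2) := by
  obtain ⟨h1, h2⟩ := h.signal y (Or.inr hy)
  have hs2 : s * s = 1 := by rw [← abs_mul_abs_self, hs, one_mul]
  have habs : σ ≤ |ηQ y - 1 / 2| := by
    have := hQ.trans (le_abs_self _)
    rwa [abs_mul, hs, one_mul] at this
  have hnn : 0 ≤ s * (ηP y - 1 / 2) := by
    have : 0 ≤ (s * (ηP y - 1 / 2)) * (s * (ηQ y - 1 / 2)) := by
      rw [mul_mul_mul_comm, hs2, one_mul]; exact h1
    exact nonneg_of_mul_nonneg_left this (hσ.trans_le hQ)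
  calc Cγ * σ ^ γ ≤ Cγ * |ηQ y - 1 / 2| ^ γ := by gcongr
    _ ≤ |ηP y - 1 / 2| := h2
    _ = |s * (ηP y - 1 / 2)| := by rw [abs_mul, hs, one_mul]
    _ = s * (ηP y - 1 / 2) := abs_of_nonneg hnn

variable [IsProbabilityMeasure P] [IsProbabilityMeasure Q]

open Classical in
/-- The classifier disagrees with the Bayes classifier with probability `O(n⁻²)` at a point where
the signal of one of the two samples is strong enough. -/
theorem wrong_decision_le (h : ParameterSpace α Cα β Cβ γ Cγ μlo μhi cμ rμ P Q ηP ηQ)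
    (hβ : 0 < β) (hCβ : 0 < Cβ) (hγ : 0 < γ) (hCγ : 0 < Cγ) (hμlo : 0 < μlo) (hcμ : 0 < cμ)
    {nP nQ : ℕ} (hn : 2 ≤ nP + nQ) {x : Covariate d} (hx : x ∈ Q.fst.support) {r Δ p L T : ℝ}
    (hL : L = Real.log ((nP : ℝ) + nQ)) (hT : T = ((d : ℝ) + 3) * L)
    (hΔ : |ηQ x - 1 / 2| = Δ) (hΔ0 : 0 < Δ) (hr0 : 0 < r) (hrμ : r ≤ rμ)
    (hr : Cβ * r ^ β ≤ Δ / 2) (hp : p = μlo * cμ * unitBallVolume d * r ^ d)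
    (hbig : (16 * L ≤ nP * p ∧ 4 * T ≤ nP * p / 2 * (Cγ * (Δ / 2) ^ γ) ^ 2) ∨
      (16 * L ≤ nQ * p ∧ 4 * T ≤ nQ * p / 2 * (Δ / 2) ^ 2)) :
    sampleLaw P Q nP nQ {Z | adaptiveClassifier Z x ≠ bayesClassifier ηQ x} ≤
      ENNReal.ofReal (5 * Real.exp (-2 * L)) := by
  have hn1 : (1 : ℝ) < (nP : ℝ) + nQ := by
    have : (2 : ℝ) ≤ ((nP + nQ : ℕ) : ℝ) := by exact_mod_cast hn
    push_cast at this; linarith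
  have hL0 : 0 < L := hL ▸ Real.log_pos hn1
  have hT0 : 0 < T := by rw [hT]; positivity
  -- `s` is the Bayes sign. The vote is shown to be strictly on its side, so the tie rule at `0`
  -- plays no role.
  obtain ⟨s, hs, hsΔ, hsgn⟩ : ∃ s : ℝ, |s| = 1 ∧ s * (ηQ x - 1 / 2) = Δ ∧
      ∀ w : ℝ, 0 < s * w → decide (0 ≤ w) = bayesClassifier ηQ x := by
    rcases le_or_gt (ηQ x) (1 / 2) with hle | hgt
    · refine ⟨-1, by simp, by rw [← hΔ, abs_of_nonpos (by linarith)]; ring, fun w hw => ?_⟩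
      simp only [bayesClassifier]
      congr 1
      exact propext ⟨fun _ => by linarith, fun _ => by linarith⟩
    · refine ⟨1, by simp, by rw [← hΔ, abs_of_nonneg (by linarith)]; ring, fun w hw => ?_⟩
      simp only [bayesClassifier]
      congr 1
      exact propext ⟨fun _ => by linarith, fun _ => by linarith⟩
  have hσP : 0 < Cγ * (Δ / 2) ^ γ := by positivity
  have hreg := h.density.regular x hx r hr0 hrμ
  have hpP : p ≤ P.fst.real (Metric.closedBall x r) := by
    rw [hp]
    exact ball_mass_ge h.density.density_source hμlo.le hcμ.le hr0.le
      (by rw [h.density.common_support]; exact hreg)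
  have hpQ : p ≤ Q.fst.real (Metric.closedBall x r) := by
    rw [hp]
    exact ball_mass_ge h.density.density_target hμlo.le hcμ.le hr0.le hreg
  let few : Set (Sample d nP nQ) := {Z | ¬ (4 * T ≤
      (Finset.univ.filter fun i => dist (Z.1 i).1 x ≤ r).card * (Cγ * (Δ / 2) ^ γ) ^ 2 ∨
    4 * T ≤ (Finset.univ.filter fun i => dist (Z.2 i).1 x ≤ r).card * (Δ / 2) ^ 2)}
  -- Only the sample favoured by `hbig` has to be plentiful: its count is at least half of `m * p`
  -- except with probability `exp (-m p / 8) ≤ exp (-2L)`.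
  have hfew : sampleLaw P Q nP nQ few ≤ ENNReal.ofReal (Real.exp (-2 * L)) := by
    rcases hbig with ⟨h1, h2⟩ | ⟨h1, h2⟩
    · have hsub : few ⊆ {z | ((Finset.univ.filter fun i => dist (z i).1 x ≤ r).card : ℝ) <
          nP * p / 2} ×ˢ univ := by
        intro Z hZ
        refine ⟨?_, mem_univ _⟩
        by_contra hge
        exact hZ (Or.inl (h2.trans (mul_le_mul_of_nonneg_right (not_lt.1 hge) (sq_nonneg _))))
      refine (measure_mono hsub).trans ?_
      rw [sampleLaw, Measure.prod_prod, measure_univ, mul_one]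
      refine (ball_count_lower_tail hpP).trans (ENNReal.ofReal_le_ofReal (Real.exp_le_exp.2 ?_))
      linarith
    · have hsub : few ⊆ univ ×ˢ {z | ((Finset.univ.filter fun i => dist (z i).1 x ≤ r).card : ℝ) <
          nQ * p / 2} := by
        intro Z hZ
        refine ⟨mem_univ _, ?_⟩
        by_contra hge
        exact hZ (Or.inr (h2.trans (mul_le_mul_of_nonneg_right (not_lt.1 hge) (sq_nonneg _))))
      refine (measure_mono hsub).trans ?_
      rw [sampleLaw, Measure.prod_prod, measure_univ, one_mul]
      refine (ball_count_lower_tail hpQ).trans (ENNReal.ofReal_le_ofReal (Real.exp_le_exp.2 ?_))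
      linarith
  -- Smoothness and relative signal are only available on the supports.
  let out : Set (Sample d nP nQ) :=
    {Z | ¬ ((∀ i, (Z.1 i).1 ∈ P.fst.support) ∧ ∀ i, (Z.2 i).1 ∈ Q.fst.support)}
  have hout : sampleLaw P Q nP nQ out = 0 := by
    have h1 : ∀ᵐ Z ∂(sampleLaw P Q nP nQ), ∀ i, (Z.1 i).1 ∈ P.fst.support :=
      Measure.quasiMeasurePreserving_fst.ae ae_pi_forall_mem
    have h2 : ∀ᵐ Z ∂(sampleLaw P Q nP nQ), ∀ i, (Z.2 i).1 ∈ Q.fst.support :=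
      Measure.quasiMeasurePreserving_snd.ae ae_pi_forall_mem
    exact h1.and h2
  -- Union over `n = exp L` steps: `n · 2 exp (-(d + 3) L) ≤ 2 exp (-2L)`.
  have hdev : ∀ D : ℕ → Set (Sample d nP nQ), (∀ k, sampleLaw P Q nP nQ (D k) ≤
      ENNReal.ofReal (2 * Real.exp (-2 * (T / 2)))) →
      sampleLaw P Q nP nQ (⋃ k ∈ Finset.Icc 1 (nP + nQ), D k) ≤
        ENNReal.ofReal (2 * Real.exp (-2 * L)) := by
    intro D hD
    refine (measure_biUnion_finset_le _ _).trans ((Finset.sum_le_sum fun k _ => hD k).trans ?_)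
    rw [Finset.sum_const, Nat.card_Icc, Nat.add_sub_cancel, nsmul_eq_mul,
      ← ENNReal.ofReal_natCast, ← ENNReal.ofReal_mul (Nat.cast_nonneg _)]
    apply ENNReal.ofReal_le_ofReal
    have hexp : ((nP + nQ : ℕ) : ℝ) = Real.exp L := by
      rw [hL, Real.exp_log (by linarith)]; push_cast; rfl
    rw [hexp, mul_left_comm, ← Real.exp_add]
    gcongr
    rw [hT]
    have : (0 : ℝ) ≤ d * L := by positivity
    linarith
  have hsub : {Z | adaptiveClassifier Z x ≠ bayesClassifier ηQ x} ⊆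
      out ∪ (few ∪ ((⋃ k ∈ Finset.Icc 1 (nP + nQ), sourceDeviation ηP x (T / 2) k) ∪
        ⋃ k ∈ Finset.Icc 1 (nP + nQ), targetDeviation ηQ x (T / 2) k)) := by
    intro Z hZ
    by_contra hc
    simp only [mem_union, not_or, mem_iUnion, not_exists, Finset.mem_Icc] at hc
    obtain ⟨ho, hf, hdP, hdQ⟩ := hc
    have ho := not_not.1 ho
    have hf := not_not.1 hf
    refine hZ (hsgn _ (adaptive_sign (hL ▸ hT) hT0 hs hσP.le (by positivity)
      (fun i hi => ?_) (fun i hi => ?_) (fun k hk => hdP k hk) (fun k hk => hdQ k hk) hf))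
    · have hy : (Z.1 i).1 ∈ Q.fst.support := h.density.common_support ▸ ho.1 i
      exact source_signal h hγ hCγ hy hs (by positivity)
        (target_signal h hβ hCβ hx hy hs hsΔ hr hi)
    · exact target_signal h hβ hCβ hx (ho.2 i) hs hsΔ hr hi
  refine (measure_mono hsub).trans ((measure_union_le _ _).trans ?_)
  rw [hout, zero_add]
  refine (measure_union_le _ _).trans ((add_le_add hfew ((measure_union_le _ _).trans
    (add_le_add (hdev _ fun k => sourceDeviation_le h.source_regression x (by positivity) k)
      (hdev _ fun k => targetDeviation_le h.target_regression x (by positivity) k)))).trans ?_)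
  -- The factor `5` is `1` for the count plus `2` for the deviations of each sample.
  rw [← ENNReal.ofReal_add (by positivity) (by positivity),
    ← ENNReal.ofReal_add (by positivity) (by positivity)]
  exact ENNReal.ofReal_le_ofReal (by linarith)

end

end Pointwise

end PosteriorDrift

namespace PosteriorDrift

/-! ### The excess risk -/

section Risk

variable {d nP nQ : ℕ} {Q : Measure (Obs d)} {η : Covariate d → ℝ}

theorem measureReal_prod_true (h : IsRegressionFunction Q η) {A : Set (Covariate d)}
    (hA : MeasurableSet A) : Q.real (A ×ˢ {true}) = ∫ x in A, η x ∂Q.fst := by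
  rw [Measure.real, h.joint A hA, integral_eq_lintegral_of_nonneg_ae
    (ae_of_all _ fun x => (h.mem_unit x).1) h.measurable.aestronglyMeasurable]

theorem measurable_bayesClassifier (hη : Measurable η) : Measurable (bayesClassifier η) := by
  refine measurable_to_bool ?_
  have : bayesClassifier η ⁻¹' {true} = η ⁻¹' Ioi (1 / 2) := by
    ext x; simp [bayesClassifier]
  rw [this]
  exact hη measurableSet_Ioi

/-- The loss at `x` of predicting `y` instead of the Bayes prediction. -/
noncomputable def localLoss (η : Covariate d → ℝ) (y : Bool) (x : Covariate d) : ENNReal :=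
  if y = bayesClassifier η x then 0 else ENNReal.ofReal |2 * η x - 1|

theorem localLoss_le_one (h : IsRegressionFunction Q η) (y : Bool) (x : Covariate d) :
    localLoss η y x ≤ 1 := by
  rw [localLoss]
  split_ifs
  · simp
  · rw [← ENNReal.ofReal_one]
    apply ENNReal.ofReal_le_ofReal
    have := h.mem_unit x
    rw [abs_le]
    exact ⟨by linarith [this.1], by linarith [this.2]⟩

theorem measurable_localLoss_adaptive (h : IsRegressionFunction Q η) :
    Measurable fun p : Sample d nP nQ × Covariate d =>
      localLoss η (adaptiveClassifier p.1 p.2) p.2 := by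
  have hb : Measurable fun p : Sample d nP nQ × Covariate d => bayesClassifier η p.2 :=
    (measurable_bayesClassifier h.measurable).comp measurable_snd
  have hη := h.measurable
  exact Measurable.ite (measurableSet_eq_fun measurable_adaptiveClassifier hb) measurable_const
    (by fun_prop)

variable [IsProbabilityMeasure Q]

theorem integrable_regression (h : IsRegressionFunction Q η) : Integrable η Q.fst :=
  Integrable.of_mem_Icc 0 1 h.measurable.aemeasurable (ae_of_all _ h.mem_unit)

theorem measureReal_prod_false (h : IsRegressionFunction Q η) {A : Set (Covariate d)}
    (hA : MeasurableSet A) : Q.real (A ×ˢ {false}) = ∫ x in A, (1 - η x) ∂Q.fst := by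
  have h1 : Q.real (A ×ˢ {true}) + Q.real (A ×ˢ {false}) = Q.fst.real A := by
    rw [← measureReal_union (by
      rw [Set.disjoint_left]; rintro ⟨x, y⟩ ⟨_, h1⟩ ⟨_, h2⟩; simp_all)
      (hA.prod (measurableSet_singleton _)), Measure.real, Measure.real, Measure.fst_apply hA]
    congr 2
    ext ⟨x, y⟩; cases y <;> simp
  rw [integral_sub (integrable_const _) (integrable_regression h).integrableOn,
    ← measureReal_prod_true h hA]
  simp only [integral_const, smul_eq_mul, mul_one, measureReal_restrict_apply_univ]
  linarith

theorem risk_eq_integral (h : IsRegressionFunction Q η) {f : Covariate d → Bool}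
    (hf : Measurable f) : risk Q f = ∫ x, (if f x then 1 - η x else η x) ∂Q.fst := by
  have hA : MeasurableSet {x | f x = true} := hf (measurableSet_singleton true)
  have hi := integrable_regression h
  have hi' : Integrable (fun x => 1 - η x) Q.fst := (integrable_const _).sub hi
  have hint : Integrable (fun x => if f x then 1 - η x else η x) Q.fst := by
    refine Integrable.of_mem_Icc 0 1 (Measurable.ite hA (measurable_const.sub h.measurable)
      h.measurable).aemeasurable (ae_of_all _ fun x => ?_)
    have := h.mem_unit x
    split_ifs
    · exact ⟨by linarith [this.2], by linarith [this.1]⟩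
    · exact this
  rw [← integral_add_compl hA hint,
    setIntegral_congr_fun (g := fun x => 1 - η x) hA fun x hx => by
      simp only [if_pos (show f x = true from hx)],
    setIntegral_congr_fun (g := η) hA.compl fun x hx => by
      simp only [if_neg (show ¬ f x = true from hx)],
    ← measureReal_prod_false h hA, ← measureReal_prod_true h hA.compl,
    ← measureReal_union (by
      rw [Set.disjoint_left]; rintro ⟨x, y⟩ ⟨_, h1⟩ ⟨_, h2⟩; simp_all)
      (hA.compl.prod (measurableSet_singleton _)), risk]
  congr 1
  ext ⟨x, y⟩
  cases y <;> cases hfx : f x <;> simp [hfx]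

/-- Given `X = x`, the two predictions have risks `η x` and `1 - η x`, which differ by `|2 η x -
1|`. The extended nonnegative form prepares Tonelli's theorem. -/
theorem excessRisk_eq_lintegral (h : IsRegressionFunction Q η) {f : Covariate d → Bool}
    (hf : Measurable f) :
    excessRisk Q η f = (∫⁻ x, localLoss η (f x) x ∂Q.fst).toReal := by
  have hb := measurable_bayesClassifier h.measurable
  have hint : ∀ {g : Covariate d → Bool}, Measurable g →
      Integrable (fun x => if g x then 1 - η x else η x) Q.fst := fun {g} hg => by
    refine Integrable.of_mem_Icc 0 1 (Measurable.ite (hg (measurableSet_singleton true))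
      (measurable_const.sub h.measurable) h.measurable).aemeasurable (ae_of_all _ fun x => ?_)
    have := h.mem_unit x
    split_ifs
    · exact ⟨by linarith [this.2], by linarith [this.1]⟩
    · exact this
  have key : ∀ x, (if f x then 1 - η x else η x) -
      (if bayesClassifier η x then 1 - η x else η x) =
      if f x = bayesClassifier η x then 0 else |2 * η x - 1| := fun x => by
    rcases le_or_gt (η x) (1 / 2) with hx | hx
    · have hbx : bayesClassifier η x = false := decide_eq_false (not_lt.2 hx)
      rw [hbx, abs_of_nonpos (by linarith)]
      cases f x <;> simp
      ring
    · have hbx : bayesClassifier η x = true := decide_eq_true hx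
      rw [hbx, abs_of_nonneg (by linarith)]
      cases f x <;> simp
      ring
  rw [excessRisk, risk_eq_integral h hf, risk_eq_integral h hb,
    ← integral_sub (hint hf) (hint hb)]
  simp_rw [key]
  rw [integral_eq_lintegral_of_nonneg_ae]
  · congr 1
    refine lintegral_congr fun x => ?_
    rw [localLoss]
    split_ifs <;> simp
  · exact ae_of_all _ fun x => by dsimp only; split_ifs <;> simp
  · exact (Measurable.ite (measurableSet_eq_fun hf hb) measurable_const
      (by have := h.measurable; fun_prop)).aestronglyMeasurable

variable {P : Measure (Obs d)} [IsProbabilityMeasure P]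

instance isProbabilityMeasure_sampleLaw : IsProbabilityMeasure (sampleLaw P Q nP nQ) := by
  unfold sampleLaw; infer_instance

theorem excessRisk_adaptive_eq (h : IsRegressionFunction Q η) (Z : Sample d nP nQ) :
    excessRisk Q η (adaptiveClassifier Z) =
      (∫⁻ x, localLoss η (adaptiveClassifier Z x) x ∂Q.fst).toReal :=
  excessRisk_eq_lintegral h
    (Measurable.of_uncurry_left (f := adaptiveClassifier) measurable_adaptiveClassifier)

theorem lintegral_localLoss_le_one (h : IsRegressionFunction Q η) (Z : Sample d nP nQ) :
    ∫⁻ x, localLoss η (adaptiveClassifier Z x) x ∂Q.fst ≤ 1 :=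
  (lintegral_mono fun x => localLoss_le_one h _ x).trans (by simp)

theorem integrable_excessRisk (h : IsRegressionFunction Q η) :
    Integrable (fun Z : Sample d nP nQ => excessRisk Q η (adaptiveClassifier Z))
      (sampleLaw P Q nP nQ) := by
  simp_rw [excessRisk_adaptive_eq h]
  refine Integrable.of_mem_Icc 0 1
    (measurable_localLoss_adaptive h).lintegral_prod_right'.ennreal_toReal.aemeasurable
    (ae_of_all _ fun Z => ⟨ENNReal.toReal_nonneg, ?_⟩)
  exact ENNReal.toReal_le_of_le_ofReal zero_le_one
    (by simpa using lintegral_localLoss_le_one h Z)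

/-- The expected excess risk is small if the classifier is rarely wrong at points with a large
signal. -/
theorem integral_excessRisk_le (h : IsRegressionFunction Q η) {δ ε m : ℝ} (hδ : 0 ≤ δ)
    (hε : 0 ≤ ε) (hm : Q.fst.real {x | |η x - 1 / 2| < δ} ≤ m)
    (hw : ∀ x ∈ Q.fst.support, δ ≤ |η x - 1 / 2| → η x ≠ 1 / 2 →
      sampleLaw P Q nP nQ {Z | adaptiveClassifier Z x ≠ bayesClassifier η x} ≤
        ENNReal.ofReal ε) :
    ∫ Z : Sample d nP nQ, excessRisk Q η (adaptiveClassifier Z) ∂(sampleLaw P Q nP nQ) ≤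
      2 * δ * m + ε := by
  have hm0 : 0 ≤ m := measureReal_nonneg.trans hm
  simp_rw [excessRisk_adaptive_eq h]
  have hmeas := measurable_localLoss_adaptive (nP := nP) (nQ := nQ) h
  rw [integral_toReal hmeas.lintegral_prod_right'.aemeasurable
    (ae_of_all _ fun Z => (lintegral_localLoss_le_one h Z).trans_lt ENNReal.one_lt_top)]
  refine ENNReal.toReal_le_of_le_ofReal (by positivity) ?_
  -- After the swap it suffices to bound the expected local loss at each fixed `x`.
  rw [lintegral_lintegral_swap hmeas.aemeasurable]
  have hset : MeasurableSet {x | |η x - 1 / 2| < δ} :=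
    measurableSet_lt (by have := h.measurable; fun_prop) measurable_const
  have hpt : ∀ᵐ x ∂Q.fst,
      ∫⁻ Z, localLoss η (adaptiveClassifier Z x) x ∂(sampleLaw P Q nP nQ) ≤
        {x | |η x - 1 / 2| < δ}.indicator (fun _ => ENNReal.ofReal (2 * δ)) x +
          ENNReal.ofReal ε := by
    filter_upwards [Measure.support_mem_ae (μ := Q.fst)] with x hx
    have habs : |2 * η x - 1| = 2 * |η x - 1 / 2| := by
      rw [show 2 * η x - 1 = 2 * (η x - 1 / 2) by ring, abs_mul, abs_two]
    by_cases hlt : |η x - 1 / 2| < δ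
    · rw [indicator_of_mem (by exact hlt)]
      refine le_add_right ((lintegral_mono (g := fun _ => ENNReal.ofReal (2 * δ))
        fun Z => ?_).trans (by simp))
      rw [localLoss]
      split_ifs
      · simp
      · exact ENNReal.ofReal_le_ofReal (by rw [habs]; linarith)
    · rw [indicator_of_notMem (by exact hlt), zero_add]
      -- No signal, but no loss either; `hw` therefore need not cover these points.
      by_cases h0 : η x = 1 / 2
      · simp [localLoss, h0]
      refine le_trans ?_ (hw x hx (not_lt.1 hlt) h0)
      have hW : MeasurableSet {Z : Sample d nP nQ |
          adaptiveClassifier Z x ≠ bayesClassifier η x} :=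
        (Measurable.of_uncurry_right (f := adaptiveClassifier) measurable_adaptiveClassifier
          (measurableSet_singleton (bayesClassifier η x))).compl
      rw [← lintegral_indicator_one hW]
      refine lintegral_mono fun Z => ?_
      by_cases hZ : adaptiveClassifier Z x = bayesClassifier η x
      · simp [localLoss, hZ]
      · rw [indicator_of_mem (by exact hZ)]
        exact localLoss_le_one h _ x
  refine (lintegral_mono_ae hpt).trans ?_
  rw [lintegral_add_right _ measurable_const, lintegral_indicator_const hset, lintegral_const,
    measure_univ, mul_one, ENNReal.ofReal_add (by positivity) hε,
    ENNReal.ofReal_mul (p := 2 * δ) (by positivity)]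
  gcongr
  rw [← ofReal_measureReal]
  exact ENNReal.ofReal_le_ofReal hm

end Risk

end PosteriorDrift

namespace PosteriorDrift

/-! ### Rates -/

/-- A signal of the order of the rate makes the expected squared signal of a sample of size `m`
exceed a multiple of the logarithm. -/
theorem le_mul_rpow_of_rate {β D g M K L N m Δ : ℝ} (hβ : 0 < β) (hD : 0 < D) (hg : 0 < g)
    (hM : 0 < M) (hL : 0 < L) (hN : 0 < N) (hm : 0 ≤ m)
    (hNm : N ≤ 2 * (m / L) ^ ((2 * β + D) / (2 * g * β + D)))
    (hK : 2 ^ (β / (2 * β + D)) * M ^ (β / (2 * g * β + D)) ≤ K)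
    (hΔ : K * N ^ (-(β / (2 * β + D))) ≤ Δ) :
    M * L ≤ m * Δ ^ ((2 * g * β + D) / β) := by
  have hgD : 0 < 2 * g * β + D := by positivity
  have hbD : 0 < 2 * β + D := by positivity
  -- An empty sample would force `N ≤ 0`.
  have hm0 : 0 < m := by
    rcases hm.eq_or_lt with h | h
    · rw [← h, zero_div, Real.zero_rpow (by positivity)] at hNm
      linarith
    · exact h
  have hmL : 0 < m / L := by positivity
  have h1 : 2 ^ (-(β / (2 * β + D))) * (m / L) ^ (-(β / (2 * g * β + D))) ≤
      N ^ (-(β / (2 * β + D))) := by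
    have := Real.rpow_le_rpow_of_nonpos hN hNm
      (by have : 0 < β / (2 * β + D) := by positivity
          linarith : -(β / (2 * β + D)) ≤ 0)
    rw [Real.mul_rpow (by norm_num) (by positivity), ← Real.rpow_mul hmL.le] at this
    convert! this using 3
    field_simp
  have h2 : M ^ (β / (2 * g * β + D)) * (m / L) ^ (-(β / (2 * g * β + D))) ≤ Δ := by
    refine le_trans ?_ hΔ
    calc _ = (2 ^ (β / (2 * β + D)) * M ^ (β / (2 * g * β + D))) *
          (2 ^ (-(β / (2 * β + D))) * (m / L) ^ (-(β / (2 * g * β + D)))) := by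
          rw [Real.rpow_neg (by norm_num : (0 : ℝ) ≤ 2)]
          field_simp
      _ ≤ K * N ^ (-(β / (2 * β + D))) := by gcongr; exact le_trans (by positivity) hK
  -- Raising to the power `(2gβ + D)/β` turns the exponent of `M` into `1` and that of `m / L` into
  -- `-1`.
  have h3 := Real.rpow_le_rpow (by positivity) h2
    (by positivity : 0 ≤ (2 * g * β + D) / β)
  rw [Real.mul_rpow (by positivity) (by positivity), ← Real.rpow_mul hM.le,
    ← Real.rpow_mul hmL.le, neg_mul, div_mul_div_cancel₀' hβ.ne', div_self hgD.ne', Real.rpow_one,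
    Real.rpow_neg_one] at h3
  calc M * L = m * (M * (m / L)⁻¹) := by field_simp
    _ ≤ _ := by gcongr

/-- The exponent splits as `2g + D/β`: `c Δ ^ (D/β)` bounds the ball mass and `κ Δ ^ g` the signal.
The count condition follows by discarding `(Δ ^ g)² ≤ 1`, the signal condition by keeping it. -/
theorem signal_sufficient {β D g c κ M L m Δ : ℝ} (hβ : 0 < β) (hg : 0 < g)
    (hc : 0 < c) (hκ : 0 < κ) (hL : 0 < L) (hm : 0 ≤ m) (hΔ : 0 < Δ) (hΔ1 : Δ ≤ 1)
    (hM1 : 16 / c ≤ M) (hM2 : 8 * (D + 3) / (c * κ ^ 2) ≤ M)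
    (h : M * L ≤ m * Δ ^ ((2 * g * β + D) / β)) :
    16 * L ≤ m * (c * Δ ^ (D / β)) ∧
      4 * ((D + 3) * L) ≤ m * (c * Δ ^ (D / β)) / 2 * (κ * Δ ^ g) ^ 2 := by
  have hsplit : Δ ^ ((2 * g * β + D) / β) = (Δ ^ g) ^ 2 * Δ ^ (D / β) := by
    rw [← Real.rpow_natCast, ← Real.rpow_mul hΔ.le, ← Real.rpow_add hΔ]
    congr 1
    push_cast
    field_simp
  rw [hsplit] at h
  have h1 : (Δ ^ g) ^ 2 ≤ 1 := pow_le_one₀ (by positivity) (Real.rpow_le_one hΔ.le hΔ1 hg.le)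
  rw [div_le_iff₀ (by positivity)] at hM1 hM2
  have h2 : (Δ ^ g) ^ 2 * Δ ^ (D / β) ≤ Δ ^ (D / β) :=
    mul_le_of_le_one_left (by positivity) h1
  constructor
  · calc 16 * L ≤ M * c * L := by gcongr
      _ = c * (M * L) := by ring
      _ ≤ c * (m * ((Δ ^ g) ^ 2 * Δ ^ (D / β))) := by gcongr
      _ ≤ c * (m * Δ ^ (D / β)) := by gcongr
      _ = _ := by ring
  · calc 4 * ((D + 3) * L) = (8 * (D + 3)) * L / 2 := by ring
      _ ≤ (M * (c * κ ^ 2)) * L / 2 := by gcongr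
      _ = c * κ ^ 2 / 2 * (M * L) := by ring
      _ ≤ c * κ ^ 2 / 2 * (m * ((Δ ^ g) ^ 2 * Δ ^ (D / β))) := by gcongr
      _ = _ := by ring

/-- A failure probability of order `n⁻²` is negligible compared to the rate. -/
theorem exp_neg_le_rate {α β γ D a b n : ℝ} (hα : 0 ≤ α) (hβ : 0 < β) (hβ1 : β ≤ 1)
    (hγ : 0 < γ) (hD : 1 ≤ D) (hαβ : α * β ≤ D) (ha : 0 ≤ a) (hb : 0 ≤ b) (hn : 2 ≤ n)
    (hab : a + b = n)
    (hN : 0 < (a / Real.log n) ^ ((2 * β + D) / (2 * γ * β + D)) + b / Real.log n) :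
    Real.exp (-2 * Real.log n) ≤ 4 * 2 ^ (β * (1 + α) / (2 * β + D)) *
      ((a / Real.log n) ^ ((2 * β + D) / (2 * γ * β + D)) + b / Real.log n) ^
        (-(β * (1 + α) / (2 * β + D))) := by
  set ρ := β * (1 + α) / (2 * β + D) with hρ
  set θ := (2 * β + D) / (2 * γ * β + D) with hθ
  have hn0 : 0 < n := by linarith
  have hL : 1 / 2 ≤ Real.log n := by
    have h1 := Real.log_le_log (by norm_num) hn
    have h2 := Real.log_two_gt_d9
    linarith
  have hL0 : 0 < Real.log n := by linarith
  have hX1 : 1 ≤ n / Real.log n := by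
    rw [one_le_div hL0]
    have := Real.log_le_sub_one_of_pos hn0
    linarith
  have hρ0 : 0 ≤ ρ := by positivity
  have hθ0 : 0 ≤ θ := by positivity
  -- `β + αβ ≤ 1 + D ≤ 2D`. This is where `αβ ≤ d` enters; it keeps the overall power of `n / log n`
  -- at most `2`.
  have hbig : β * (1 + α) ≤ 2 * D := by nlinarith
  have hθρ : θ * ρ ≤ 2 := by
    rw [hθ, hρ, div_mul_div_cancel₀' (by positivity), div_le_iff₀ (by positivity)]
    have : 0 < γ * β := by positivity
    nlinarith
  have hρ2 : ρ ≤ 2 := by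
    rw [hρ, div_le_iff₀ (by positivity)]
    nlinarith
  set X := n / Real.log n with hX
  have hX0 : 0 < X := by positivity
  have hNX : (a / Real.log n) ^ θ + b / Real.log n ≤ 2 * X ^ max θ 1 := by
    have h1 : (a / Real.log n) ^ θ ≤ X ^ max θ 1 := by
      calc _ ≤ X ^ θ := by
            apply Real.rpow_le_rpow (by positivity) _ hθ0
            rw [hX]; gcongr; linarith
        _ ≤ _ := Real.rpow_le_rpow_of_exponent_le hX1 (le_max_left _ _)
    have h2 : b / Real.log n ≤ X ^ max θ 1 := by
      calc _ ≤ X := by rw [hX]; gcongr; linarith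
        _ = X ^ (1 : ℝ) := (Real.rpow_one _).symm
        _ ≤ _ := Real.rpow_le_rpow_of_exponent_le hX1 (le_max_right _ _)
    linarith
  have hmax : max θ 1 * ρ ≤ 2 := by
    rcases max_choice θ 1 with h | h <;> rw [h]
    · exact hθρ
    · linarith
  have hNρ : ((a / Real.log n) ^ θ + b / Real.log n) ^ ρ ≤ 4 * 2 ^ ρ * n ^ 2 := by
    calc _ ≤ (2 * X ^ max θ 1) ^ ρ := Real.rpow_le_rpow hN.le hNX hρ0
      _ = 2 ^ ρ * X ^ (max θ 1 * ρ) := by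
          rw [Real.mul_rpow (by norm_num) (by positivity), ← Real.rpow_mul hX0.le]
      _ ≤ 2 ^ ρ * X ^ (2 : ℝ) := by
          gcongr
      _ ≤ 2 ^ ρ * (4 * n ^ 2) := by
          gcongr
          rw [Real.rpow_two, hX, div_pow, div_le_iff₀ (by positivity)]
          have : 1 ≤ 4 * Real.log n ^ 2 := by nlinarith
          nlinarith [sq_nonneg n]
      _ = _ := by ring
  rw [Real.rpow_neg hN.le, ← div_eq_mul_inv, le_div_iff₀ (by positivity),
    show -2 * Real.log n = -(2 * Real.log n) by ring, Real.exp_neg, two_mul, Real.exp_add,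
    Real.exp_log hn0, ← sq, inv_mul_le_iff₀ (by positivity)]
  linarith

end PosteriorDrift

namespace PosteriorDrift

/-! ### The risk bound -/

/-- A radius proportional to `Δ ^ (1 / β)` on which a signal of size `Δ` is halved at most. -/
theorem exists_radius_constant {β Cβ rμ : ℝ} (hβ : 0 < β) (hCβ : 0 < Cβ) (hrμ : 0 < rμ) :
    ∃ c : ℝ, 0 < c ∧ ∀ Δ : ℝ, 0 < Δ → Δ ≤ 1 →
      c * Δ ^ (1 / β) ≤ rμ ∧ Cβ * (c * Δ ^ (1 / β)) ^ β ≤ Δ / 2 := by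
  -- The second entry gives `Cβ * c ^ β ≤ 1/2`; the first suffices for `rμ` because `Δ ≤ 1`.
  refine ⟨min rμ ((1 / (2 * Cβ)) ^ (1 / β)), lt_min hrμ (by positivity), fun Δ h0 h1 => ?_⟩
  set c := min rμ ((1 / (2 * Cβ)) ^ (1 / β)) with hc
  have hc0 : 0 < c := lt_min hrμ (by positivity)
  constructor
  · have h2 : Δ ^ (1 / β) ≤ 1 := Real.rpow_le_one h0.le h1 (by positivity)
    calc c * Δ ^ (1 / β) ≤ c := mul_le_of_le_one_right hc0.le h2
      _ ≤ rμ := min_le_left _ _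
  · have h2 : c ^ β ≤ 1 / (2 * Cβ) := by
      calc c ^ β ≤ ((1 / (2 * Cβ)) ^ (1 / β)) ^ β := by gcongr; exact min_le_right _ _
        _ = _ := by rw [← Real.rpow_mul (by positivity), one_div_mul_cancel hβ.ne', Real.rpow_one]
    rw [Real.mul_rpow hc0.le (by positivity), ← Real.rpow_mul h0.le, one_div_mul_cancel hβ.ne',
      Real.rpow_one]
    calc Cβ * (c ^ β * Δ) ≤ Cβ * (1 / (2 * Cβ) * Δ) := by gcongr
      _ = _ := by field_simp

end PosteriorDrift

theorem theorem3 (d : ℕ) (hd : 1 ≤ d)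
    (α Cα β Cβ γ Cγ μlo μhi cμ rμ : ℝ)
    (hα : 0 ≤ α) (hCα : 0 < Cα) (hβ : 0 < β) (hβ1 : β ≤ 1) (hCβ : 0 < Cβ)
    (hγ : 0 < γ) (hCγ : 0 < Cγ) (hμlo : 0 < μlo) (hcμ : 0 < cμ) (hrμ : 0 < rμ)
    (hαβ : α * β ≤ d) :
    ∃ C : ℝ, 0 < C ∧ ∀ nP nQ : ℕ, 2 ≤ nP + nQ →
      ∀ (P Q : MeasureTheory.Measure (PosteriorDrift.Obs d))
        [MeasureTheory.IsProbabilityMeasure P] [MeasureTheory.IsProbabilityMeasure Q]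
        (ηP ηQ : PosteriorDrift.Covariate d → ℝ),
        PosteriorDrift.ParameterSpace α Cα β Cβ γ Cγ μlo μhi cμ rμ P Q ηP ηQ →
        MeasureTheory.Integrable
          (fun Z : PosteriorDrift.Sample d nP nQ =>
            PosteriorDrift.excessRisk Q ηQ (PosteriorDrift.adaptiveClassifier Z))
          (PosteriorDrift.sampleLaw P Q nP nQ) ∧
        ∫ Z : PosteriorDrift.Sample d nP nQ,
            PosteriorDrift.excessRisk Q ηQ (PosteriorDrift.adaptiveClassifier Z)
            ∂(PosteriorDrift.sampleLaw P Q nP nQ) ≤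
          C * (((nP : ℝ) / Real.log ((nP : ℝ) + nQ)) ^ ((2 * β + d) / (2 * γ * β + d)) +
            (nQ : ℝ) / Real.log ((nP : ℝ) + nQ)) ^ (-(β * (1 + α) / (2 * β + d))) := by
  open PosteriorDrift in
  obtain ⟨c₀, hc₀, hrad⟩ := exists_radius_constant hβ hCβ hrμ
  have hdR : (1 : ℝ) ≤ d := by exact_mod_cast hd
  have hd0 : (0 : ℝ) < d := by linarith
  have hvol := unitBallVolume_pos d
  set c₁ := μlo * cμ * unitBallVolume d * c₀ ^ d with hc₁
  have hc₁0 : 0 < c₁ := by positivity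
  set κ := Cγ * (1 / 2) ^ γ with hκ
  have hκ0 : 0 < κ := by positivity
  -- The sum dominates the thresholds of `signal_sufficient` for the source (signal constant `κ`)
  -- and the target (signal constant `1/2`).
  set M := 16 / c₁ + 8 * ((d : ℝ) + 3) / (c₁ * κ ^ 2) +
    8 * ((d : ℝ) + 3) / (c₁ * (1 / 2) ^ 2) with hM
  have hM1 : 0 < 16 / c₁ := by positivity
  have hM2 : 0 < 8 * ((d : ℝ) + 3) / (c₁ * κ ^ 2) := by positivity
  have hM3 : 0 < 8 * ((d : ℝ) + 3) / (c₁ * (1 / 2) ^ 2) := by positivity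
  have hM0 : 0 < M := by positivity
  -- One summand for each sample, `g = γ` and `g = 1`; the powers of `2` absorb the bound of `N` by
  -- twice its larger term.
  set K := 2 ^ (β / (2 * β + d)) * M ^ (β / (2 * γ * β + d)) +
    2 ^ (β / (2 * β + d)) * M ^ (β / (2 * 1 * β + d)) with hK
  have hK1 : 0 < 2 ^ (β / (2 * β + d)) * M ^ (β / (2 * γ * β + d)) := by positivity
  have hK2 : 0 < 2 ^ (β / (2 * β + d)) * M ^ (β / (2 * 1 * β + d)) := by positivity
  have hK0 : 0 < K := by positivity
  -- The first term comes from `2δ · Cα δ ^ α`; in the second, `20` is `5` from the failure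
  -- probability times `4` from `exp_neg_le_rate`.
  refine ⟨2 * Cα * K ^ (1 + α) + 20 * 2 ^ (β * (1 + α) / (2 * β + d)), by positivity, ?_⟩
  intro nP nQ hn P Q _ _ ηP ηQ h
  refine ⟨integrable_excessRisk h.target_regression, ?_⟩
  have hnR : (2 : ℝ) ≤ (nP : ℝ) + nQ := by exact_mod_cast hn
  set L := Real.log ((nP : ℝ) + nQ) with hL
  have hL0 : 0 < L := Real.log_pos (by linarith)
  set N := ((nP : ℝ) / L) ^ ((2 * β + d) / (2 * γ * β + d)) + (nQ : ℝ) / L with hN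
  have hA0 : 0 ≤ ((nP : ℝ) / L) ^ ((2 * β + d) / (2 * γ * β + d)) := by positivity
  have hB0 : 0 ≤ (nQ : ℝ) / L := by positivity
  have hN0 : 0 < N := by
    rcases Nat.eq_zero_or_pos nQ with h0 | h0
    · have hP0 : (0 : ℝ) < nP := by rw [h0] at hnR; push_cast at hnR; linarith
      have : 0 < ((nP : ℝ) / L) ^ ((2 * β + d) / (2 * γ * β + d)) := by positivity
      linarith
    · have : (0 : ℝ) < nQ := by exact_mod_cast h0
      have : 0 < (nQ : ℝ) / L := by positivity
      linarith
  set δ := K * N ^ (-(β / (2 * β + d))) with hδ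
  have hδ0 : 0 < δ := by positivity
  have hmain := integral_excessRisk_le (P := P) (nP := nP) (nQ := nQ) h.target_regression
    hδ0.le (ε := 5 * Real.exp (-2 * L)) (by positivity) (h.margin δ hδ0) fun x hx hδx hne => by
      set Δ := |ηQ x - 1 / 2| with hΔ
      have hΔ0 : 0 < Δ := abs_pos.2 (sub_ne_zero.2 hne)
      have hΔ1 : Δ ≤ 1 := by
        have := h.target_regression.mem_unit x
        rw [hΔ, abs_le]
        exact ⟨by linarith [this.1], by linarith [this.2]⟩
      obtain ⟨hr1, hr2⟩ := hrad Δ hΔ0 hΔ1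
      have hp : c₁ * Δ ^ ((d : ℝ) / β) =
          μlo * cμ * unitBallVolume d * (c₀ * Δ ^ (1 / β)) ^ d := by
        rw [mul_pow, ← Real.rpow_natCast (Δ ^ (1 / β)), ← Real.rpow_mul hΔ0.le, hc₁,
          show 1 / β * (d : ℝ) = d / β by ring]
        ring
      refine wrong_decision_le h hβ hCβ hγ hCγ hμlo hcμ hn hx hL rfl hΔ.symm hΔ0
        (by positivity) hr1 hr2 hp ?_
      have hhalf : Cγ * (Δ / 2) ^ γ = κ * Δ ^ γ := by
        rw [hκ, div_eq_mul_one_div Δ 2, Real.mul_rpow hΔ0.le (by norm_num)]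
        ring
      have hhalf' : Δ / 2 = 1 / 2 * Δ ^ (1 : ℝ) := by rw [Real.rpow_one]; ring
      -- The sample contributing the larger term of `N` is the one that decides.
      rcases le_total ((nQ : ℝ) / L) (((nP : ℝ) / L) ^ ((2 * β + d) / (2 * γ * β + d)))
        with hle | hle
      · left
        rw [hhalf]
        exact signal_sufficient hβ hγ hc₁0 hκ0 hL0 (Nat.cast_nonneg _) hΔ0 hΔ1
          (by linarith) (by linarith)
          (le_mul_rpow_of_rate hβ hd0 hγ hM0 hL0 hN0 (Nat.cast_nonneg _) (by linarith)
            (by linarith) hδx)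
      · right
        rw [hhalf']
        refine signal_sufficient hβ one_pos hc₁0 (by norm_num) hL0 (Nat.cast_nonneg _) hΔ0 hΔ1
          (by linarith) (by linarith)
          (le_mul_rpow_of_rate hβ hd0 one_pos hM0 hL0 hN0 (Nat.cast_nonneg _) ?_
            (by linarith) hδx)
        -- For `g = 1` the exponent of `m / L` is `1`, matching the target term of `N`.
        rw [mul_one, div_self (by positivity), Real.rpow_one]
        linarith
  refine hmain.trans ?_
  have h1 : 2 * δ * (Cα * δ ^ α) =
      2 * Cα * K ^ (1 + α) * N ^ (-(β * (1 + α) / (2 * β + d))) := by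
    have : δ * δ ^ α = δ ^ (1 + α) := by rw [Real.rpow_add hδ0, Real.rpow_one]
    rw [show 2 * δ * (Cα * δ ^ α) = 2 * Cα * (δ * δ ^ α) by ring, this, hδ,
      Real.mul_rpow hK0.le (by positivity), ← Real.rpow_mul hN0.le,
      show -(β / (2 * β + d)) * (1 + α) = -(β * (1 + α) / (2 * β + d)) by ring]
    ring
  have h2 := exp_neg_le_rate hα hβ hβ1 hγ hdR hαβ (Nat.cast_nonneg nP) (Nat.cast_nonneg nQ)
    hnR rfl hN0
  rw [h1, add_mul]
  linarith
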